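/- Let $\mathbf h\in\mathbb C^{n}$, $\mathbf h\neq 0$, and $P_T\ge 0$. Let $\mathbf g\sim CN(0,\mathbf I_n)$ be a circularly symmetric complex Gaussian vector. For positive semidefinite Hermitian matrices $\mathbf S_u,\mathbf S_v\in\mathbb C^{n\times n}$ put $$R(\mathbf S_u,\mathbf S_v)=\left(\log\frac{1+\mathbf h^H(\mathbf S_u+\mathbf S_v)\mathbf h}{1+\mathbf h^H\mathbf S_v\mathbf h}-\mathbf E\left[\log\frac{1+\mathbf g^H(\mathbf S_u+\mathbf S_v)\mathbf g}{1+\mathbf g^H\mathbf S_v\mathbf g}\right]\right)^+ ,$$ the ergodic secrecy rate of the multiple-input single-output wiretap channel with main channel $\mathbf h$, fast fading single-antenna eavesdropper channel $\mathbf g$, signal covariance $\mathbf S_u$ and artificial-noise covariance $\mathbf S_v$, where $(x)^+=\max\{0,x\}$. Let $R_{GAN}$ be the supremum of $R$ over all pairs with $\mathbf S_u\succeq 0$, $\mathbf S_v\succeq 0$, $\mathrm{tr}(\mathbf S_u+\mathbf S_v)\le P_T$. Then $R_{GAN}$ is attained by a pair $(\mathbf S_u^*,\mathbf S_v^*)$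 with $$\mathbf S_u^*=\frac{P_U}{\|\mathbf h\|^2}\,\mathbf h\mathbf h^H,\qquad P_U=\mathrm{tr}(\mathbf S_u^*)\ge 0 .$$ Moreover, if $R_{GAN}>0$, then every maximizing pair $(\mathbf S_u^*,\mathbf S_v^*)$ satisfies this formula with $P_U=\mathrm{tr}(\mathbf S_u^*)>0$; in particular, $\mathbf S_u^*$ has rank one. -/

import Mathlib

open MeasureTheory ProbabilityTheory Matrix
open scoped ComplexOrder

noncomputable section

/-- The circularly symmetric complex Gaussian law `CN(0, 1)` on `ℂ`: real and imaginary parts are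
independent real centred Gaussians of variance `1 / 2`. -/
def complexGaussian : Measure ℂ :=
  ((gaussianReal 0 (1 / 2)).prod (gaussianReal 0 (1 / 2))).map
    (fun p : ℝ × ℝ => (p.1 : ℂ) + (p.2 : ℂ) * Complex.I)

/-- The law `CN(0, I_n)` on `ℂⁿ`: independent `CN(0, 1)` coordinates. -/
def complexGaussianVector (n : ℕ) : Measure (Fin n → ℂ) :=
  Measure.pi (fun _ => complexGaussian)

/-- The quadratic form `xᴴ S x` (real for Hermitian `S`). -/
def quadForm {n : ℕ} (S : Matrix (Fin n) (Fin n) ℂ) (x : Fin n → ℂ) : ℝ :=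
  (star x ⬝ᵥ (S *ᵥ x)).re

/-- The feasible pairs `(S_u, S_v)` of signal and artificial-noise covariance matrices:
both positive semidefinite, with total power `tr (S_u + S_v)` at most `PT`. -/
def feasibleSet (n : ℕ) (PT : ℝ) :
    Set (Matrix (Fin n) (Fin n) ℂ × Matrix (Fin n) (Fin n) ℂ) :=
  {S | S.1.PosSemidef ∧ S.2.PosSemidef ∧ ((S.1 + S.2).trace).re ≤ PT}

/-- The ergodic secrecy rate
`(log ((1 + hᴴ(S_u+S_v)h) / (1 + hᴴ S_v h)) - E[log ((1 + gᴴ(S_u+S_v)g) / (1 + gᴴ S_v g))])⁺`,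
`g ∼ CN(0, I_n)`, of Gaussian signalling with covariance `S_u = S.1` and Gaussian artificial noise
with covariance `S_v = S.2`. -/
def secrecyRate {n : ℕ} (h : EuclideanSpace ℂ (Fin n))
    (S : Matrix (Fin n) (Fin n) ℂ × Matrix (Fin n) (Fin n) ℂ) : ℝ :=
  max 0
    (Real.log ((1 + quadForm (S.1 + S.2) h.ofLp) / (1 + quadForm S.2 h.ofLp)) -
      ∫ g, Real.log ((1 + quadForm (S.1 + S.2) g) / (1 + quadForm S.2 g))
        ∂(complexGaussianVector n))

/-- The pair `S = (S_u, S_v)` is optimal: it is feasible and maximizes the secrecy rate over all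
feasible pairs. -/
def IsOptimalPair {n : ℕ} (h : EuclideanSpace ℂ (Fin n)) (PT : ℝ)
    (S : Matrix (Fin n) (Fin n) ℂ × Matrix (Fin n) (Fin n) ℂ) : Prop :=
  S ∈ feasibleSet n PT ∧ IsMaxOn (secrecyRate h) (feasibleSet n PT) S

/-- The optimal value `R_GAN` of the secrecy-rate problem. -/
def ganRate {n : ℕ} (h : EuclideanSpace ℂ (Fin n)) (PT : ℝ) : ℝ :=
  sSup (secrecyRate h '' feasibleSet n PT)

/-- The covariance `(PU / ‖h‖²) h hᴴ` of a beamformer of power `PU` aligned with `h`. -/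
def beamformingCov {n : ℕ} (h : EuclideanSpace ℂ (Fin n)) (PU : ℝ) :
    Matrix (Fin n) (Fin n) ℂ :=
  ((PU / ‖h‖ ^ 2 : ℝ) : ℂ) • vecMulVec h.ofLp (star h.ofLp)

end

/-! A maximizer exists because the feasible set is compact and the rate is continuous on it. If the
maximum is zero, the zero pair attains it, so the content lies in a maximizer of positive rate.

Rank one: fix the noise and move the signal covariance by `±D` with `D` trace-free. Optimality in
both directions, combined with concavity of the logarithm, forces the relative change `quadForm D /
(1 + quadForm (S_u + S_v))` to be constant. It vanishes at the origin, so it is zero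
(`quadForm_eq_zero_of_optimal`). Two positive eigenvalues of the signal covariance would allow a
nonzero such `D`; hence it is `u uᴴ`.

Alignment: rotate so that the noise is `diag b`. The Gaussian law is unitarily invariant, so an
optimal pair also beats every feasible pair for every channel of the same norm. Take `α = 1/‖h‖²`.
The best channel for a given `u` turns the signal-to-noise ratio into `uᴴ (α + diag b)⁻¹ u`, so `u`
maximizes `log (1 + ∑ s k / (α + b k)) - loadedRate b s`, `s k = |u k|²`, at fixed total load. This
objective has no maximizer that charges two unequal `b k`: when load is transferred between them,
every critical point has positive second derivative (`exists_load_gt`). Thus `u` lies in one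
eigenspace of the noise. The equality case of Cauchy-Schwarz makes `h` proportional to `(α + diag
b)⁻¹ u`, hence to `u`.

The second-derivative claim rests on the Frullani formula, which writes the ergodic rate through `1
/ det (1 + τ S)`. The determinant is affine in the transferred load, and what remains is the
integral inequality `sq_integral_lt_two_mul_integral`. -/

/-! ### A weighted integral inequality on the half-line -/

theorem integrableOn_pow_mul_exp_neg (k : ℕ) :
    IntegrableOn (fun τ : ℝ => τ ^ k * Real.exp (-τ)) (Set.Ioi 0) := by
  have := Real.GammaIntegral_convergent (s := k + 1) (by positivity)
  refine this.congr_fun (fun x _ => ?_) measurableSet_Ioi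
  simp [mul_comm]

theorem integrableOn_pow_mul_of_le_exp_neg (k : ℕ) {f : ℝ → ℝ} (hf : Measurable f)
    (h0 : ∀ τ, 0 < τ → 0 ≤ f τ) (h1 : ∀ τ, 0 < τ → f τ ≤ Real.exp (-τ)) :
    IntegrableOn (fun τ : ℝ => τ ^ k * f τ) (Set.Ioi 0) := by
  refine (integrableOn_pow_mul_exp_neg k).mono' (by fun_prop) ?_
  filter_upwards [ae_restrict_mem measurableSet_Ioi] with τ hτ
  have hτ' : 0 < τ := hτ
  rw [Real.norm_of_nonneg (mul_nonneg (by positivity) (h0 τ hτ'))]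
  exact mul_le_mul_of_nonneg_left (h1 τ hτ') (by positivity)

theorem two_mul_integral_le_sq {w : ℝ → ℝ} (hw : Continuous w) (hw1 : ∀ τ, 0 < τ → w τ ≤ 1)
    {y : ℝ} (hy : 0 ≤ y) : 2 * ∫ τ in (0 : ℝ)..y, τ * w τ ≤ y ^ 2 := by
  have : ∫ τ in (0 : ℝ)..y, τ * w τ ≤ ∫ τ in (0 : ℝ)..y, τ := by
    refine intervalIntegral.integral_mono_on_of_le_Ioo hy
      (Continuous.intervalIntegrable (by fun_prop) _ _)
      (Continuous.intervalIntegrable (by fun_prop) _ _) (fun τ hτ => ?_)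
    nlinarith [hw1 τ hτ.1, hτ.1]
  rw [integral_id] at this
  linarith

/-- A weighted reverse Cauchy-Schwarz type bound for decreasing functions. -/
theorem sq_integral_lt_two_mul_integral {L L' w : ℝ → ℝ} (hL : Continuous L)
    (hLpos : ∀ τ, 0 ≤ τ → 0 < L τ) (hL1 : ∀ τ, 0 ≤ τ → L τ ≤ 1)
    (hLd : ∀ τ, 0 < τ → HasDerivAt L (L' τ) τ) (hL' : ∀ τ, 0 < τ → L' τ ≤ 0)
    (hLlim : Filter.Tendsto L Filter.atTop (nhds 0)) (hw : Continuous w)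
    (hwpos : ∀ τ, 0 < τ → 0 < w τ) (hwexp : ∀ τ, 0 < τ → w τ ≤ Real.exp (-τ)) :
    (∫ τ in Set.Ioi 0, τ * L τ ^ 2 * w τ) ^ 2 < 2 * ∫ τ in Set.Ioi 0, τ ^ 3 * L τ ^ 3 * w τ := by
  have hw1 : ∀ τ, 0 < τ → w τ ≤ 1 := fun τ hτ =>
    (hwexp τ hτ).trans (Real.exp_le_one_iff.2 (by linarith))
  have hLw : ∀ k τ, 0 < τ → L τ ^ k * w τ ≤ Real.exp (-τ) := fun k τ hτ =>
    (mul_le_of_le_one_left (hwpos τ hτ).le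
      (pow_le_one₀ (hLpos τ hτ.le).le (hL1 τ hτ.le))).trans (hwexp τ hτ)
  have hLw0 : ∀ k τ, 0 < τ → 0 < L τ ^ k * w τ := fun k τ hτ =>
    mul_pos (pow_pos (hLpos τ hτ.le) k) (hwpos τ hτ)
  have hiW : IntegrableOn (fun τ => τ * w τ) (Set.Ioi 0) := by
    simpa using integrableOn_pow_mul_of_le_exp_neg 1 hw.measurable (fun τ hτ => (hwpos τ hτ).le)
      hwexp
  have hiI : IntegrableOn (fun τ => τ * L τ ^ 2 * w τ) (Set.Ioi 0) := by
    simpa [mul_assoc] using integrableOn_pow_mul_of_le_exp_neg 1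
      (f := fun τ => L τ ^ 2 * w τ) (by fun_prop) (fun τ hτ => (hLw0 2 τ hτ).le) (hLw 2)
  have hiT : IntegrableOn (fun τ => τ ^ 3 * L τ ^ 3 * w τ) (Set.Ioi 0) := by
    simpa [mul_assoc] using integrableOn_pow_mul_of_le_exp_neg 3
      (f := fun τ => L τ ^ 3 * w τ) (by fun_prop) (fun τ hτ => (hLw0 3 τ hτ).le) (hLw 3)
  set I := ∫ τ in Set.Ioi 0, τ * L τ ^ 2 * w τ with hI
  set T := ∫ τ in Set.Ioi 0, τ ^ 3 * L τ ^ 3 * w τ with hT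
  have hTpos : 0 < T := by
    rw [hT, setIntegral_pos_iff_support_of_nonneg_ae _ hiT]
    · have : Function.support (fun τ => τ ^ 3 * L τ ^ 3 * w τ) ∩ Set.Ioi 0 = Set.Ioi 0 := by
        refine Set.inter_eq_right.2 fun τ hτ => ?_
        have h : (0 : ℝ) < τ := hτ
        have := mul_pos (pow_pos h 3) (hLw0 3 τ h)
        rw [Function.mem_support, mul_assoc]
        exact this.ne'
      rw [this]; simp
    · filter_upwards [ae_restrict_mem measurableSet_Ioi] with τ hτ
      have h : (0 : ℝ) < τ := hτ
      have := mul_pos (pow_pos h 3) (hLw0 3 τ h)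
      simpa [mul_assoc] using this.le
  let W : ℝ → ℝ := fun y => ∫ τ in (0 : ℝ)..y, τ * w τ
  let I₀ : ℝ → ℝ := fun y => ∫ τ in (0 : ℝ)..y, τ * L τ ^ 2 * w τ
  let T₀ : ℝ → ℝ := fun y => ∫ τ in (0 : ℝ)..y, τ ^ 3 * L τ ^ 3 * w τ
  have hWd : ∀ y, HasDerivAt W (y * w y) y := fun y =>
    (Continuous.integral_hasStrictDerivAt (by fun_prop) 0 y).hasDerivAt
  have hId : ∀ y, HasDerivAt I₀ (y * L y ^ 2 * w y) y := fun y =>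
    (Continuous.integral_hasStrictDerivAt (by fun_prop) 0 y).hasDerivAt
  have hTd : ∀ y, HasDerivAt T₀ (y ^ 3 * L y ^ 3 * w y) y := fun y =>
    (Continuous.integral_hasStrictDerivAt (by fun_prop) 0 y).hasDerivAt
  have hWlim := intervalIntegral_tendsto_integral_Ioi 0 hiW Filter.tendsto_id
  have hIlim := intervalIntegral_tendsto_integral_Ioi 0 hiI Filter.tendsto_id
  have hTlim := intervalIntegral_tendsto_integral_Ioi 0 hiT Filter.tendsto_id
  -- The correction terms are chosen so that the derivative is `(4/3) y L³ w (y² - 2W) + (-L') (I -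
  -- 2LW)²`, with both summands nonnegative because `w ≤ 1` and `L` decreases.
  let V : ℝ → ℝ := fun y => (4 / 3) * T₀ y + I ^ 2 * (1 - L y) - 2 * I * I₀ y
    + 2 * I * (L y ^ 2 * W y) - (4 / 3) * (L y ^ 3 * W y ^ 2)
  have hWc : Continuous W := continuous_iff_continuousAt.2 fun y => (hWd y).continuousAt
  have hIc : Continuous I₀ := continuous_iff_continuousAt.2 fun y => (hId y).continuousAt
  have hTc : Continuous T₀ := continuous_iff_continuousAt.2 fun y => (hTd y).continuousAt
  have hVmono : MonotoneOn V (Set.Ici 0) := by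
    refine monotoneOn_of_hasDerivWithinAt_nonneg (convex_Ici 0)
      (f' := fun y => (4 / 3) * (y * L y ^ 3 * w y) * (y ^ 2 - 2 * W y)
        + (- L' y) * (I - 2 * (L y * W y)) ^ 2)
      (Continuous.continuousOn (by fun_prop)) (fun y hy => ?_) (fun y hy => ?_)
    · rw [interior_Ici] at hy
      have h : HasDerivAt V _ y := (((((hTd y).const_mul (4 / 3 : ℝ)).add
        (((hLd y hy).const_sub 1).const_mul (I ^ 2))).sub ((hId y).const_mul (2 * I))).add
        ((((hLd y hy).pow 2).mul (hWd y)).const_mul (2 * I))).sub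
        ((((hLd y hy).pow 3).mul ((hWd y).pow 2)).const_mul (4 / 3 : ℝ))
      refine (h.congr_deriv ?_).hasDerivWithinAt
      simp only [Pi.pow_apply, Nat.add_one_sub_one, pow_one, Nat.cast_ofNat]
      ring
    · rw [interior_Ici] at hy
      have hy' : (0 : ℝ) < y := hy
      have h1 := two_mul_integral_le_sq hw hw1 hy'.le
      have h2 := mul_pos hy' (hLw0 3 y hy')
      have h3 := hL' y hy'
      have h4 : 0 ≤ y * L y ^ 3 * w y := by rw [mul_assoc]; exact h2.le
      have h5 : 0 ≤ y ^ 2 - 2 * W y := by simpa [W] using h1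
      have h6 : 0 ≤ - L' y := by linarith
      positivity
  have hV0 : 0 ≤ V 0 := by
    have : V 0 = I ^ 2 * (1 - L 0) := by simp [V, W, I₀, T₀]
    rw [this]
    exact mul_nonneg (sq_nonneg _) (by linarith [hL1 0 le_rfl])
  have hVlim : Filter.Tendsto V Filter.atTop (nhds ((4 / 3) * T + I ^ 2 * (1 - 0) - 2 * I * I
      + 2 * I * (0 ^ 2 * ∫ τ in Set.Ioi 0, τ * w τ)
      - (4 / 3) * (0 ^ 3 * (∫ τ in Set.Ioi 0, τ * w τ) ^ 2))) :=
    ((((hTlim.const_mul _).add ((hLlim.const_sub 1).const_mul _)).sub (hIlim.const_mul _)).add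
      (((hLlim.pow 2).mul hWlim).const_mul _)).sub
      (((hLlim.pow 3).mul (hWlim.pow 2)).const_mul _)
  -- The limit of `V` is `(4/3) T - I²`, so `I² ≤ (4/3) T`; strictness below `2 T` comes from `T >
  -- 0`.
  have hVnn := ge_of_tendsto hVlim (Filter.eventually_ge_atTop (0 : ℝ) |>.mono fun y hy =>
    hV0.trans (hVmono (Set.mem_Ici.2 le_rfl) hy hy))
  nlinarith

/-! ### The complex Gaussian law: unitary invariance and Laplace transform -/

instance isProbabilityMeasure_complexGaussian : IsProbabilityMeasure complexGaussian :=
  Measure.isProbabilityMeasure_map (by fun_prop)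

instance isProbabilityMeasure_complexGaussianVector (n : ℕ) :
    IsProbabilityMeasure (complexGaussianVector n) := by
  unfold complexGaussianVector; infer_instance

instance isOpenPosMeasure_complexGaussian : complexGaussian.IsOpenPosMeasure := by
  have : (gaussianReal 0 (1 / 2)).IsOpenPosMeasure :=
    (gaussianReal_absolutelyContinuous' 0 (by norm_num)).isOpenPosMeasure
  refine Continuous.isOpenPosMeasure_map (by fun_prop) fun z => ⟨(z.re, z.im), ?_⟩
  simp

instance isOpenPosMeasure_complexGaussianVector (n : ℕ) :
    (complexGaussianVector n).IsOpenPosMeasure := by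
  unfold complexGaussianVector; infer_instance

theorem charFunDual_complexGaussian (L : StrongDual ℝ ℂ) (c : ℂ) (hL : ∀ z, L z = (c * z).re) :
    charFunDual complexGaussian L = Complex.exp (-(Complex.normSq c : ℂ) / 4) := by
  rw [charFunDual_apply, complexGaussian, integral_map (by fun_prop) (by fun_prop)]
  have h : ∀ p : ℝ × ℝ, Complex.exp (L ((p.1 : ℂ) + p.2 * Complex.I) * Complex.I)
      = Complex.exp (c.re * p.1 * Complex.I) * Complex.exp (((-c.im : ℝ) : ℂ) * p.2 * Complex.I) := by
    intro p
    rw [hL, ← Complex.exp_add]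
    congr 1
    simp
    ring
  simp_rw [h]
  rw [integral_prod_mul (fun x : ℝ => Complex.exp (c.re * x * Complex.I))
    (fun x : ℝ => Complex.exp (((-c.im : ℝ) : ℂ) * x * Complex.I)), ← charFun_apply_real,
    ← charFun_apply_real, charFun_gaussianReal, charFun_gaussianReal, ← Complex.exp_add]
  congr 1
  rw [Complex.normSq_apply]
  push_cast
  ring

theorem charFunDual_complexGaussianVector {n : ℕ} (L : StrongDual ℝ (Fin n → ℂ)) (c : Fin n → ℂ)
    (hL : ∀ z, L z = (c ⬝ᵥ z).re) :
    charFunDual (complexGaussianVector n) L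
      = Complex.exp (-((∑ i, Complex.normSq (c i) : ℝ) : ℂ) / 4) := by
  rw [complexGaussianVector, charFunDual_pi]
  have : ∀ i, charFunDual complexGaussian (L.comp (.single ℝ (fun _ => ℂ) i))
      = Complex.exp (-(Complex.normSq (c i) : ℂ) / 4) := fun i =>
    charFunDual_complexGaussian _ _ fun z => by simp [hL]
  simp_rw [this, ← Complex.exp_sum]
  congr 1
  push_cast
  rw [← Finset.sum_div, ← Finset.sum_neg_distrib]

theorem exists_dotProduct_re_eq {n : ℕ} (L : StrongDual ℝ (Fin n → ℂ)) :
    ∃ c : Fin n → ℂ, ∀ z, L z = (c ⬝ᵥ z).re := by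
  refine ⟨fun i => L (Pi.single i 1) - L (Pi.single i Complex.I) * Complex.I, fun z => ?_⟩
  have hz : z = ∑ i, ((z i).re • (Pi.single i 1 : Fin n → ℂ)
      + (z i).im • (Pi.single i Complex.I : Fin n → ℂ)) := by
    conv_lhs => rw [← Finset.univ_sum_single z]
    refine Finset.sum_congr rfl fun i _ => ?_
    ext j
    by_cases hj : j = i
    · subst hj; simp
    · simp [hj]
  conv_lhs => rw [hz]
  simp only [map_sum, map_add, map_smul, dotProduct, Complex.re_sum]
  refine Finset.sum_congr rfl fun i _ => ?_
  simp
  ring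

theorem sum_normSq_eq {n : ℕ} (c : Fin n → ℂ) :
    ((∑ i, Complex.normSq (c i) : ℝ) : ℂ) = c ⬝ᵥ star c := by
  simp [dotProduct, Complex.mul_conj]

/-- The characteristic function at the functional with coefficients `c` depends only on the norm of
`c`, and pulling back by `U` replaces `c` by `c ᵥ* U`, which has the same norm. -/
theorem complexGaussianVector_map_unitary {n : ℕ} {U : Matrix (Fin n) (Fin n) ℂ}
    (hU : U ∈ unitaryGroup (Fin n) ℂ) :
    (complexGaussianVector n).map (fun z => U *ᵥ z) = complexGaussianVector n := by
  let F : (Fin n → ℂ) →L[ℝ] (Fin n → ℂ) :=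
    (LinearMap.toContinuousLinearMap (U.mulVecLin.restrictScalars ℝ))
  have : IsProbabilityMeasure ((complexGaussianVector n).map F) :=
    Measure.isProbabilityMeasure_map F.continuous.aemeasurable
  change (complexGaussianVector n).map F = _
  refine Measure.ext_of_charFunDual (funext fun L => ?_)
  obtain ⟨c, hc⟩ := exists_dotProduct_re_eq L
  rw [charFunDual_map, charFunDual_complexGaussianVector _ (c ᵥ* U),
    charFunDual_complexGaussianVector L c hc, sum_normSq_eq, sum_normSq_eq, star_vecMul,
    ← dotProduct_mulVec, mulVec_mulVec, ← star_eq_conjTranspose, mem_unitaryGroup_iff.1 hU,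
    one_mulVec]
  intro z
  rw [← dotProduct_mulVec]
  exact hc _

theorem integral_comp_unitary_mulVec {n : ℕ} {U : Matrix (Fin n) (Fin n) ℂ}
    (hU : U ∈ unitaryGroup (Fin n) ℂ) {f : (Fin n → ℂ) → ℝ} (hf : Continuous f) :
    ∫ g, f (U *ᵥ g) ∂(complexGaussianVector n) = ∫ g, f g ∂(complexGaussianVector n) := by
  conv_rhs => rw [← complexGaussianVector_map_unitary hU]
  rw [integral_map (by fun_prop) (by fun_prop)]

theorem integral_exp_neg_mul_sq_gaussianReal {c : ℝ} (hc : 0 ≤ c) :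
    ∫ x, Real.exp (-(c * x ^ 2)) ∂(gaussianReal 0 (1 / 2)) = (√(1 + c))⁻¹ := by
  rw [integral_gaussianReal_eq_integral_smul (by norm_num)]
  have : ∀ x : ℝ, gaussianPDFReal 0 (1 / 2) x • Real.exp (-(c * x ^ 2))
      = (√Real.pi)⁻¹ * Real.exp (-(1 + c) * x ^ 2) := by
    intro x
    have h2 : 2 * Real.pi * ((1 / 2 : NNReal) : ℝ) = Real.pi := by push_cast; ring
    rw [gaussianPDFReal, smul_eq_mul, mul_assoc, ← Real.exp_add, h2]
    congr 2
    push_cast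
    ring
  simp_rw [this]
  rw [integral_const_mul, integral_gaussian, Real.sqrt_div Real.pi_pos.le]
  have := Real.sqrt_pos.2 Real.pi_pos
  field_simp

theorem integral_exp_neg_mul_normSq_complexGaussian {c : ℝ} (hc : 0 ≤ c) :
    ∫ z, Real.exp (-(c * Complex.normSq z)) ∂complexGaussian = (1 + c)⁻¹ := by
  have hcont : Continuous fun z : ℂ => Real.exp (-(c * Complex.normSq z)) := by
    have := Complex.continuous_normSq
    fun_prop
  rw [complexGaussian, integral_map (by fun_prop) hcont.aestronglyMeasurable]
  have h : ∀ p : ℝ × ℝ, Real.exp (-(c * Complex.normSq ((p.1 : ℂ) + p.2 * Complex.I)))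
      = Real.exp (-(c * p.1 ^ 2)) * Real.exp (-(c * p.2 ^ 2)) := by
    intro p
    rw [Complex.normSq_add_mul_I, ← Real.exp_add]
    congr 1
    ring
  simp_rw [h]
  rw [integral_prod_mul (fun x : ℝ => Real.exp (-(c * x ^ 2)))
    (fun x : ℝ => Real.exp (-(c * x ^ 2))), integral_exp_neg_mul_sq_gaussianReal hc,
    ← mul_inv, Real.mul_self_sqrt (by linarith)]

theorem integral_exp_neg_sum_complexGaussianVector {n : ℕ} {a : Fin n → ℝ} (ha : ∀ i, 0 ≤ a i) :
    ∫ g, Real.exp (-∑ i, a i * Complex.normSq (g i)) ∂(complexGaussianVector n)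
      = (∏ i, (1 + a i))⁻¹ := by
  simp_rw [← Finset.sum_neg_distrib, Real.exp_sum]
  rw [complexGaussianVector, integral_fintype_prod_eq_prod
    (fun i z => Real.exp (-(a i * Complex.normSq z)))]
  simp_rw [integral_exp_neg_mul_normSq_complexGaussian (ha _)]
  rw [Finset.prod_inv_distrib]

theorem integrable_normSq_complexGaussian : Integrable (fun z => Complex.normSq z) complexGaussian := by
  have hcont := Complex.continuous_normSq
  rw [complexGaussian, integrable_map_measure hcont.aestronglyMeasurable (by fun_prop)]
  have h : Integrable (fun x : ℝ => x ^ 2) (gaussianReal 0 (1 / 2)) :=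
    (memLp_id_gaussianReal 2).integrable_sq
  have := (h.comp_fst (gaussianReal 0 (1 / 2))).add (h.comp_snd (gaussianReal 0 (1 / 2)))
  refine this.congr (Filter.Eventually.of_forall fun p => ?_)
  simp [Complex.normSq_add_mul_I]

theorem integrable_normSq_complexGaussianVector {n : ℕ} (i : Fin n) :
    Integrable (fun g => Complex.normSq (g i)) (complexGaussianVector n) := by
  have h := measurePreserving_eval (fun _ : Fin n => complexGaussian) i
  exact h.integrable_comp_of_integrable integrable_normSq_complexGaussian

/-! ### Quadratic forms and unitary diagonalization -/

section QuadForm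

variable {n : ℕ}

theorem quadForm_add (S T : Matrix (Fin n) (Fin n) ℂ) (x : Fin n → ℂ) :
    quadForm (S + T) x = quadForm S x + quadForm T x := by
  simp [quadForm, add_mulVec, dotProduct_add]

theorem quadForm_sub (S T : Matrix (Fin n) (Fin n) ℂ) (x : Fin n → ℂ) :
    quadForm (S - T) x = quadForm S x - quadForm T x := by
  simp [quadForm, sub_mulVec, dotProduct_sub]

theorem quadForm_nonneg {S : Matrix (Fin n) (Fin n) ℂ} (hS : S.PosSemidef) (x : Fin n → ℂ) :
    0 ≤ quadForm S x :=
  hS.re_dotProduct_nonneg x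

theorem quadForm_vecMulVec (u x : Fin n → ℂ) :
    quadForm (vecMulVec u (star u)) x = Complex.normSq (star u ⬝ᵥ x) := by
  have h : star x ⬝ᵥ u = star (star u ⬝ᵥ x) := by
    rw [← star_dotProduct_star, star_star, dotProduct_comm]
  rw [quadForm, vecMulVec_mulVec, dotProduct_smul, h]
  simp only [MulOpposite.smul_eq_mul_unop, MulOpposite.unop_op, Complex.star_def]
  rw [← Complex.normSq_eq_conj_mul_self, Complex.ofReal_re]

theorem quadForm_diagonal (b : Fin n → ℝ) (x : Fin n → ℂ) :
    quadForm (diagonal fun k => (b k : ℂ)) x = ∑ k, b k * Complex.normSq (x k) := by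
  simp only [quadForm, dotProduct, mulVec_diagonal, Complex.re_sum, Complex.normSq_apply,
    Pi.star_apply]
  refine Finset.sum_congr rfl fun k _ => ?_
  simp
  ring

theorem quadForm_conj (U S : Matrix (Fin n) (Fin n) ℂ) (x : Fin n → ℂ) :
    quadForm (U * S * Uᴴ) x = quadForm S (Uᴴ *ᵥ x) := by
  rw [quadForm, quadForm, star_mulVec, conjTranspose_conjTranspose, ← mulVec_mulVec,
    ← mulVec_mulVec, ← dotProduct_mulVec]

theorem continuous_quadForm (S : Matrix (Fin n) (Fin n) ℂ) : Continuous (quadForm S) := by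
  unfold quadForm; fun_prop

theorem continuous_quadForm_left (x : Fin n → ℂ) :
    Continuous fun S : Matrix (Fin n) (Fin n) ℂ => quadForm S x := by
  unfold quadForm; fun_prop

theorem sum_normSq_unitary_mulVec {U : Matrix (Fin n) (Fin n) ℂ}
    (hU : U ∈ unitaryGroup (Fin n) ℂ) (x : Fin n → ℂ) :
    ∑ i, Complex.normSq ((U *ᵥ x) i) = ∑ i, Complex.normSq (x i) := by
  have h := quadForm_conj Uᴴ 1 x
  rw [Matrix.mul_one, conjTranspose_conjTranspose, ← star_eq_conjTranspose,
    mem_unitaryGroup_iff'.1 hU] at h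
  have h1 : (1 : Matrix (Fin n) (Fin n) ℂ) = diagonal fun _ => ((1 : ℝ) : ℂ) := by simp
  rw [h1, quadForm_diagonal, quadForm_diagonal] at h
  simpa using h.symm

theorem Matrix.PosSemidef.exists_unitary_diagonal {S : Matrix (Fin n) (Fin n) ℂ}
    (hS : S.PosSemidef) : ∃ U ∈ unitaryGroup (Fin n) ℂ, ∃ a : Fin n → ℝ, (∀ k, 0 ≤ a k) ∧
      S = U * diagonal (fun k => (a k : ℂ)) * Uᴴ := by
  refine ⟨hS.1.eigenvectorUnitary, hS.1.eigenvectorUnitary.2, hS.1.eigenvalues,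
    hS.eigenvalues_nonneg, ?_⟩
  conv_lhs => rw [hS.1.spectral_theorem, Unitary.conjStarAlgAut_apply]
  rfl

theorem conjTranspose_mem_unitaryGroup {U : Matrix (Fin n) (Fin n) ℂ}
    (hU : U ∈ unitaryGroup (Fin n) ℂ) : Uᴴ ∈ unitaryGroup (Fin n) ℂ := by
  rw [← star_eq_conjTranspose]; exact Unitary.star_mem hU

theorem trace_unitary_conj {U : Matrix (Fin n) (Fin n) ℂ}
    (hU : U ∈ unitaryGroup (Fin n) ℂ) (S : Matrix (Fin n) (Fin n) ℂ) :
    (U * S * Uᴴ).trace = S.trace := by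
  rw [trace_mul_cycle, ← star_eq_conjTranspose, mem_unitaryGroup_iff'.1 hU, Matrix.one_mul]

/-- Supplies the integrable majorant, uniform over bounded trace, behind integrability and
continuity of the ergodic rate. -/
theorem quadForm_le_trace_mul {S : Matrix (Fin n) (Fin n) ℂ} (hS : S.PosSemidef)
    (x : Fin n → ℂ) : quadForm S x ≤ S.trace.re * ∑ i, Complex.normSq (x i) := by
  obtain ⟨U, hU, a, ha, rfl⟩ := hS.exists_unitary_diagonal
  rw [quadForm_conj, quadForm_diagonal, trace_unitary_conj hU,
    ← sum_normSq_unitary_mulVec (conjTranspose_mem_unitaryGroup hU) x, trace_diagonal,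
    Complex.re_sum, Finset.sum_mul]
  refine Finset.sum_le_sum fun k _ => mul_le_mul_of_nonneg_left ?_ (ha k)
  exact Finset.single_le_sum (f := fun i => Complex.normSq ((Uᴴ *ᵥ x) i))
    (fun i _ => Complex.normSq_nonneg _) (Finset.mem_univ k)

end QuadForm

/-! ### The ergodic rate as an integral of inverse determinants -/

/-- The ergodic rate `E[log (1 + gᴴ S g)]`, `g ∼ CN(0, I_n)`. -/
noncomputable def ergodicRate {n : ℕ} (S : Matrix (Fin n) (Fin n) ℂ) : ℝ :=
  ∫ g, Real.log (1 + quadForm S g) ∂(complexGaussianVector n)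

section ErgodicRate

variable {n : ℕ} {S : Matrix (Fin n) (Fin n) ℂ}

theorem continuous_log_one_add_quadForm (hS : S.PosSemidef) :
    Continuous fun g => Real.log (1 + quadForm S g) :=
  ((continuous_quadForm S).const_add 1).log fun g => by linarith [quadForm_nonneg hS g]

theorem integrable_quadForm (hS : S.PosSemidef) :
    Integrable (quadForm S) (complexGaussianVector n) := by
  refine ((integrable_finsetSum Finset.univ fun i _ =>
    integrable_normSq_complexGaussianVector i).const_mul S.trace.re).mono'
    (continuous_quadForm S).aestronglyMeasurable (Filter.Eventually.of_forall fun g => ?_)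
  rw [Real.norm_of_nonneg (quadForm_nonneg hS g)]
  exact quadForm_le_trace_mul hS g

theorem norm_log_one_add_le {s : ℝ} (hs : 0 ≤ s) : ‖Real.log (1 + s)‖ ≤ s := by
  rw [Real.norm_of_nonneg (Real.log_nonneg (by linarith))]
  linarith [Real.log_le_sub_one_of_pos (show 0 < 1 + s by linarith)]

theorem integrable_log_one_add_quadForm (hS : S.PosSemidef) :
    Integrable (fun g => Real.log (1 + quadForm S g)) (complexGaussianVector n) :=
  (integrable_quadForm hS).mono' (continuous_log_one_add_quadForm hS).aestronglyMeasurable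
    (Filter.Eventually.of_forall fun g => norm_log_one_add_le (quadForm_nonneg hS g))

theorem posSemidef_unitary_conj (hS : S.PosSemidef) (U : Matrix (Fin n) (Fin n) ℂ) :
    (U * S * Uᴴ).PosSemidef :=
  hS.mul_mul_conjTranspose_same U

theorem ergodicRate_unitary_conj (hS : S.PosSemidef) {U : Matrix (Fin n) (Fin n) ℂ}
    (hU : U ∈ unitaryGroup (Fin n) ℂ) : ergodicRate (U * S * Uᴴ) = ergodicRate S := by
  simp_rw [ergodicRate, quadForm_conj]
  exact integral_comp_unitary_mulVec (conjTranspose_mem_unitaryGroup hU)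
    (continuous_log_one_add_quadForm hS)

theorem secrecyRate_eq {h : EuclideanSpace ℂ (Fin n)}
    {S : Matrix (Fin n) (Fin n) ℂ × Matrix (Fin n) (Fin n) ℂ} (h1 : S.1.PosSemidef)
    (h2 : S.2.PosSemidef) : secrecyRate h S = max 0
      (Real.log (1 + quadForm (S.1 + S.2) h.ofLp) - Real.log (1 + quadForm S.2 h.ofLp)
        - (ergodicRate (S.1 + S.2) - ergodicRate S.2)) := by
  have hp : ∀ {T : Matrix (Fin n) (Fin n) ℂ} (_ : T.PosSemidef) (x : Fin n → ℂ),
      1 + quadForm T x ≠ 0 := fun hT x => by linarith [quadForm_nonneg hT x]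
  rw [secrecyRate, Real.log_div (hp (h1.add h2) _) (hp h2 _), ergodicRate, ergodicRate,
    ← integral_sub (integrable_log_one_add_quadForm (h1.add h2))
      (integrable_log_one_add_quadForm h2)]
  simp_rw [Real.log_div (hp (h1.add h2) _) (hp h2 _)]

theorem inv_mul_exp_sub_exp_nonneg {s τ : ℝ} (hs : 0 ≤ s) (hτ : 0 < τ) :
    0 ≤ τ⁻¹ * (Real.exp (-τ) * (1 - Real.exp (-(τ * s)))) := by
  have : Real.exp (-(τ * s)) ≤ 1 := Real.exp_le_one_iff.2 (by nlinarith)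
  have := sub_nonneg.2 this
  positivity

theorem inv_mul_exp_sub_exp_le {s τ : ℝ} (hτ : 0 < τ) :
    τ⁻¹ * (Real.exp (-τ) * (1 - Real.exp (-(τ * s)))) ≤ Real.exp (-τ) * s := by
  have h := Real.one_sub_le_exp_neg (τ * s)
  rw [inv_mul_le_iff₀ hτ]
  nlinarith [Real.exp_pos (-τ)]

theorem integrableOn_exp_neg : IntegrableOn (fun τ : ℝ => Real.exp (-τ)) (Set.Ioi 0) := by
  simpa using integrableOn_pow_mul_exp_neg 0

/-- Frullani's integral for `exp (-τ)` at the scales `1` and `1 + s`. -/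
theorem integral_inv_mul_exp_sub_exp {s : ℝ} (hs : 0 ≤ s) :
    ∫ τ in Set.Ioi (0 : ℝ), τ⁻¹ * (Real.exp (-τ) * (1 - Real.exp (-(τ * s))))
      = Real.log (1 + s) := by
  have hc : Continuous fun τ : ℝ => Real.exp (-τ) := by fun_prop
  have heq : ∀ τ : ℝ, τ⁻¹ * (Real.exp (-τ) * (1 - Real.exp (-(τ * s))))
      = τ⁻¹ • (Real.exp (-(1 * τ)) - Real.exp (-((1 + s) * τ))) := by
    intro τ
    rw [smul_eq_mul, mul_sub, ← Real.exp_add]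
    ring_nf
  have hint : IntegrableOn (fun τ : ℝ => τ⁻¹ * (Real.exp (-τ) * (1 - Real.exp (-(τ * s)))))
      (Set.Ioi 0) := by
    refine (integrableOn_exp_neg.mul_const s).mono' (by fun_prop) ?_
    filter_upwards [ae_restrict_mem measurableSet_Ioi] with τ hτ
    rw [Real.norm_of_nonneg (inv_mul_exp_sub_exp_nonneg hs hτ)]
    exact inv_mul_exp_sub_exp_le hτ
  simp_rw [heq] at hint ⊢
  rw [Frullani.integral_Ioi_eq (f := fun τ => Real.exp (-τ)) (L := 1) (R := 0)
    (hc.locallyIntegrable.locallyIntegrableOn _) one_pos (by linarith) _ _ hint]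
  · simp
  · have := hc.tendsto 0
    simp only [neg_zero, Real.exp_zero] at this
    exact this.mono_left nhdsWithin_le_nhds
  · exact Real.tendsto_exp_neg_atTop_nhds_zero

/-- After diagonalization the coordinates are independent, and the one with eigenvalue `a k`
contributes `1 / (1 + τ a k)`. -/
theorem integral_exp_neg_mul_quadForm (hS : S.PosSemidef) {τ : ℝ} (hτ : 0 ≤ τ) :
    ∫ g, Real.exp (-(τ * quadForm S g)) ∂(complexGaussianVector n)
      = ((1 + (τ : ℂ) • S).det.re)⁻¹ := by
  obtain ⟨U, hU, a, ha, rfl⟩ := hS.exists_unitary_diagonal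
  simp_rw [quadForm_conj]
  rw [integral_comp_unitary_mulVec (conjTranspose_mem_unitaryGroup hU)
    (f := fun g => Real.exp (-(τ * quadForm (diagonal fun k => (a k : ℂ)) g)))]
  · simp_rw [quadForm_diagonal, Finset.mul_sum, ← mul_assoc]
    rw [integral_exp_neg_sum_complexGaussianVector fun i => mul_nonneg hτ (ha i)]
    congr 1
    have h1 : 1 + (τ : ℂ) • (U * diagonal (fun k => (a k : ℂ)) * Uᴴ)
        = U * diagonal (fun k => ((1 + τ * a k : ℝ) : ℂ)) * Uᴴ := by
      have : diagonal (fun k => ((1 + τ * a k : ℝ) : ℂ))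
          = 1 + (τ : ℂ) • diagonal (fun k => (a k : ℂ)) := by
        ext i j
        by_cases hij : i = j
        · subst hij; simp
        · simp [hij]
      rw [this, Matrix.mul_add, Matrix.add_mul, Matrix.mul_one, ← star_eq_conjTranspose,
        mem_unitaryGroup_iff.1 hU, Matrix.mul_smul, Matrix.smul_mul]
    rw [h1, det_mul_right_comm, ← star_eq_conjTranspose, mem_unitaryGroup_iff.1 hU,
      Matrix.one_mul, det_diagonal, ← Complex.ofReal_prod, Complex.ofReal_re]
  · have := continuous_quadForm (diagonal fun k => (a k : ℂ))
    fun_prop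

/-- Take expectations in the Frullani formula. Fubini applies because the integrand is dominated by
`quadForm S g * exp (-τ)`. -/
theorem ergodicRate_eq_integral_det (hS : S.PosSemidef) :
    ergodicRate S = ∫ τ in Set.Ioi (0 : ℝ),
      τ⁻¹ * (Real.exp (-τ) * (1 - ((1 + (τ : ℂ) • S).det.re)⁻¹)) := by
  have hq := continuous_quadForm S
  rw [ergodicRate]
  simp_rw [← integral_inv_mul_exp_sub_exp (quadForm_nonneg hS _)]
  rw [integral_integral_swap]
  · refine setIntegral_congr_fun measurableSet_Ioi fun τ hτ => ?_
    have hτ' : (0 : ℝ) < τ := hτ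
    have hi : Integrable (fun g => Real.exp (-(τ * quadForm S g))) (complexGaussianVector n) := by
      refine (integrable_const (1 : ℝ)).mono' (by fun_prop) (Filter.Eventually.of_forall fun g => ?_)
      rw [Real.norm_of_nonneg (Real.exp_pos _).le]
      exact Real.exp_le_one_iff.2 (by nlinarith [quadForm_nonneg hS g])
    rw [integral_const_mul, integral_const_mul, integral_sub (integrable_const _) hi,
      integral_exp_neg_mul_quadForm hS hτ'.le]
    simp
  · have hd : Integrable (fun p : (Fin n → ℂ) × ℝ => quadForm S p.1 * Real.exp (-p.2))
        ((complexGaussianVector n).prod (volume.restrict (Set.Ioi 0))) :=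
      (integrable_quadForm hS).mul_prod integrableOn_exp_neg
    refine hd.mono' (Measurable.aestronglyMeasurable (by have := hq.measurable; fun_prop)) ?_
    have : ∀ᵐ p : (Fin n → ℂ) × ℝ ∂((complexGaussianVector n).prod
        (volume.restrict (Set.Ioi 0))), 0 < p.2 :=
      Measure.quasiMeasurePreserving_snd.ae (ae_restrict_mem measurableSet_Ioi)
    filter_upwards [this] with p hp
    rw [Function.uncurry_apply_pair,
      Real.norm_of_nonneg (inv_mul_exp_sub_exp_nonneg (quadForm_nonneg hS _) hp), mul_comm (quadForm _ _)]
    exact inv_mul_exp_sub_exp_le hp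

end ErgodicRate

/-! ### First and second order conditions at a maximum -/

/-- First and second order consequences of a two-sided logarithmic bound near `0`. -/
theorem two_mul_le_sq_of_log_le {r I₁ I₂ t₀ : ℝ} (ht₀ : 0 < t₀)
    (hpos : ∀ t, 0 < t → t < t₀ → 0 < 1 + t * r) (hneg : ∀ t, 0 < t → t < t₀ → 0 < 1 - t * r)
    (h₁ : ∀ t, 0 < t → t < t₀ → Real.log (1 + t * r) ≤ t * I₁)
    (h₂ : ∀ t, 0 < t → t < t₀ → Real.log (1 - t * r) ≤ -(t * I₁))
    (h₃ : ∀ t, 0 < t → t < t₀ → Real.log (1 + t * r) + Real.log (1 - t * r) ≤ -(2 * t ^ 2 * I₂)) :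
    2 * I₂ ≤ I₁ ^ 2 := by
  have hev : ∀ᶠ t in nhdsWithin (0 : ℝ) (Set.Ioi 0), 0 < t ∧ t < t₀ := by
    filter_upwards [Ioo_mem_nhdsGT ht₀] with t ht using ht
  have hlim : ∀ f : ℝ → ℝ, Continuous f →
      Filter.Tendsto f (nhdsWithin (0 : ℝ) (Set.Ioi 0)) (nhds (f 0)) := fun f hf =>
    (hf.tendsto 0).mono_left nhdsWithin_le_nhds
  -- Bound the logarithm below by `1 - x⁻¹`, divide by `t` and let `t` tend to `0`; with `hr₂` this
  -- gives `r = I₁`.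
  have hr₁ : r ≤ I₁ := by
    have := le_of_tendsto_of_tendsto (hlim (fun _ => r) (by fun_prop))
      (hlim (fun t => I₁ * (1 + t * r)) (by fun_prop)) (hev.mono fun t ht => by
        have hp := hpos t ht.1 ht.2
        have := (Real.one_sub_inv_le_log_of_pos hp).trans (h₁ t ht.1 ht.2)
        have h' : t * r ≤ t * (I₁ * (1 + t * r)) := by
          have h4 := mul_le_mul_of_nonneg_right this hp.le
          rw [sub_mul, inv_mul_cancel₀ hp.ne'] at h4
          linarith
        exact le_of_mul_le_mul_left h' ht.1)
    simpa using this
  have hr₂ : I₁ ≤ r := by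
    have := le_of_tendsto_of_tendsto (hlim (fun t => I₁ * (1 - t * r)) (by fun_prop))
      (hlim (fun _ => r) (by fun_prop)) (hev.mono fun t ht => by
        have hp := hneg t ht.1 ht.2
        have := (Real.one_sub_inv_le_log_of_pos hp).trans (h₂ t ht.1 ht.2)
        have h' : t * (I₁ * (1 - t * r)) ≤ t * r := by
          have h4 := mul_le_mul_of_nonneg_right this hp.le
          rw [sub_mul, inv_mul_cancel₀ hp.ne'] at h4
          linarith
        exact le_of_mul_le_mul_left h' ht.1)
    simpa using this
  have hr : I₁ = r := le_antisymm hr₂ hr₁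
  -- The two logarithms combine into `log (1 - t² r²)`, so the same lower bound, now divided by
  -- `t²`, gives the second-order statement.
  have := le_of_tendsto_of_tendsto
    (hlim (fun t => 2 * I₂ * (1 - t ^ 2 * r ^ 2)) (by fun_prop))
    (hlim (fun _ => r ^ 2) (by fun_prop)) (hev.mono fun t ht => by
      have hp := mul_pos (hpos t ht.1 ht.2) (hneg t ht.1 ht.2)
      have h5 := h₃ t ht.1 ht.2
      rw [← Real.log_mul (hpos t ht.1 ht.2).ne' (hneg t ht.1 ht.2).ne'] at h5
      have := (Real.one_sub_inv_le_log_of_pos hp).trans h5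
      have h' : t ^ 2 * (2 * I₂ * (1 - t ^ 2 * r ^ 2)) ≤ t ^ 2 * r ^ 2 := by
        have h4 := mul_le_mul_of_nonneg_right this hp.le
        rw [sub_mul, inv_mul_cancel₀ hp.ne'] at h4
        nlinarith
      exact le_of_mul_le_mul_left h' (by have := ht.1; positivity))
  rw [hr]
  simpa using this

/-! ### The determinant of diagonal noise plus a rank-one load -/

/-- `det (1 + τ (diag b + u uᴴ))` for `s k = |u k|²`. -/
noncomputable def loadedDet {n : ℕ} (b s : Fin n → ℝ) (τ : ℝ) : ℝ :=
  (∏ k, (1 + τ * b k)) * (1 + ∑ k, τ * s k / (1 + τ * b k))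

section LoadedDet

variable {n : ℕ} {b s : Fin n → ℝ}

theorem measurable_loadedDet (b s : Fin n → ℝ) : Measurable (loadedDet b s) := by
  unfold loadedDet; fun_prop

theorem one_le_loadedDet (hb : ∀ k, 0 ≤ b k) (hs : ∀ k, 0 ≤ s k) {τ : ℝ} (hτ : 0 ≤ τ) :
    1 ≤ loadedDet b s τ := by
  have h1 : 1 ≤ ∏ k, (1 + τ * b k) :=
    Finset.one_le_prod fun k _ => by nlinarith [mul_nonneg hτ (hb k)]
  have h2 : 0 ≤ ∑ k, τ * s k / (1 + τ * b k) := Finset.sum_nonneg fun k _ => by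
    have := mul_nonneg hτ (hb k)
    have := mul_nonneg hτ (hs k)
    positivity
  unfold loadedDet
  nlinarith

/-- Gives `1 - 1/loadedDet = O(τ)`, which cancels the singularity `τ⁻¹` in `loadedRate`. -/
theorem loadedDet_le_exp (hb : ∀ k, 0 ≤ b k) (hs : ∀ k, 0 ≤ s k) {τ : ℝ} (hτ : 0 ≤ τ) :
    loadedDet b s τ ≤ Real.exp (τ * (∑ k, b k + ∑ k, s k)) := by
  rw [mul_add, Real.exp_add, loadedDet]
  have h2 : 0 ≤ ∑ k, τ * s k / (1 + τ * b k) := Finset.sum_nonneg fun k _ => by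
    have := mul_nonneg hτ (hb k)
    have := mul_nonneg hτ (hs k)
    positivity
  refine mul_le_mul ?_ ?_ (by linarith) (Real.exp_pos _).le
  · rw [Finset.mul_sum, Real.exp_sum]
    exact Finset.prod_le_prod (fun k _ => by have := mul_nonneg hτ (hb k); linarith)
      fun k _ => by linarith [Real.add_one_le_exp (τ * b k)]
  · have : ∑ k, τ * s k / (1 + τ * b k) ≤ τ * ∑ k, s k := by
      rw [Finset.mul_sum]
      exact Finset.sum_le_sum fun k _ => div_le_self (mul_nonneg hτ (hs k))
        (by have := mul_nonneg hτ (hb k); linarith)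
    linarith [Real.add_one_le_exp (τ * ∑ k, s k)]

/-- The ergodic rate of `diag b + u uᴴ`, `s k = |u k|²`, as an integral over a half-line. -/
noncomputable def loadedRate (b s : Fin n → ℝ) : ℝ :=
  ∫ τ in Set.Ioi (0 : ℝ), τ⁻¹ * (Real.exp (-τ) * (1 - (loadedDet b s τ)⁻¹))

theorem integrableOn_loadedRate (hb : ∀ k, 0 ≤ b k) (hs : ∀ k, 0 ≤ s k) :
    IntegrableOn (fun τ => τ⁻¹ * (Real.exp (-τ) * (1 - (loadedDet b s τ)⁻¹))) (Set.Ioi 0) := by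
  have hm := measurable_loadedDet b s
  refine (integrableOn_exp_neg.mul_const (∑ k, b k + ∑ k, s k)).mono'
    (Measurable.aestronglyMeasurable (by fun_prop)) ?_
  filter_upwards [ae_restrict_mem measurableSet_Ioi] with τ hτ
  have hτ' : (0 : ℝ) < τ := hτ
  have h1 := one_le_loadedDet hb hs hτ'.le
  have h2 : (Real.exp (τ * (∑ k, b k + ∑ k, s k)))⁻¹ ≤ (loadedDet b s τ)⁻¹ :=
    inv_anti₀ (by linarith) (loadedDet_le_exp hb hs hτ'.le)
  rw [← Real.exp_neg] at h2
  have h3 := Real.one_sub_le_exp_neg (τ * (∑ k, b k + ∑ k, s k))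
  have h4 : (loadedDet b s τ)⁻¹ ≤ 1 := inv_le_one_of_one_le₀ h1
  rw [Real.norm_of_nonneg (by have := sub_nonneg.2 h4; positivity), inv_mul_le_iff₀ hτ']
  nlinarith [Real.exp_pos (-τ)]

/-- Moving the load `t` from coordinate `j` to coordinate `i`. -/
def transfer (s : Fin n → ℝ) (i j : Fin n) (t : ℝ) : Fin n → ℝ :=
  s + (Pi.single i t - Pi.single j t)

theorem sum_transfer_mul (s f : Fin n → ℝ) (i j : Fin n) (t : ℝ) :
    ∑ k, transfer s i j t k * f k = ∑ k, s k * f k + t * (f i - f j) := by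
  simp only [transfer, Pi.add_apply, Pi.sub_apply, add_mul, sub_mul, Finset.sum_add_distrib,
    Finset.sum_sub_distrib, Pi.single_apply, ite_mul, zero_mul, Finset.sum_ite_eq',
    Finset.mem_univ, if_true]
  ring

theorem sum_transfer (s : Fin n → ℝ) (i j : Fin n) (t : ℝ) :
    ∑ k, transfer s i j t k = ∑ k, s k := by
  simpa using sum_transfer_mul s 1 i j t

theorem transfer_nonneg (hs : ∀ k, 0 ≤ s k) {i j : Fin n} {t : ℝ} (hi : |t| ≤ s i)
    (hj : |t| ≤ s j) (k : Fin n) : 0 ≤ transfer s i j t k := by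
  have h1 := abs_le.1 hi
  have h2 := abs_le.1 hj
  have h3 := hs k
  simp only [transfer, Pi.add_apply, Pi.sub_apply, Pi.single_apply]
  split_ifs with h h' h'
  · linarith
  · subst h; linarith
  · subst h'; linarith
  · linarith

theorem prod_eq_mul_mul_prod_erase {f : Fin n → ℝ} {i j : Fin n} (hij : i ≠ j) :
    ∏ k, f k = f i * f j * ∏ k ∈ (Finset.univ.erase i).erase j, f k := by
  rw [mul_assoc, Finset.mul_prod_erase _ _ (by simp [hij.symm]),
    Finset.mul_prod_erase _ _ (Finset.mem_univ i)]

/-- The determinant is affine in the load; the slope comes from `1/(1 + τ b i) - 1/(1 + τ b j)`,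
whose denominators cancel two factors of the product. -/
theorem loadedDet_transfer (hb : ∀ k, 0 ≤ b k) {i j : Fin n} (hij : i ≠ j) (t : ℝ) {τ : ℝ}
    (hτ : 0 ≤ τ) : loadedDet b (transfer s i j t) τ = loadedDet b s τ
      + t * (τ ^ 2 * (b j - b i) * ∏ k ∈ (Finset.univ.erase i).erase j, (1 + τ * b k)) := by
  have h0 : ∀ k, 1 + τ * b k ≠ 0 := fun k => by have := mul_nonneg hτ (hb k); linarith
  have h := sum_transfer_mul s (fun k => τ / (1 + τ * b k)) i j t
  have h' : ∀ s : Fin n → ℝ, ∑ k, τ * s k / (1 + τ * b k) = ∑ k, s k * (τ / (1 + τ * b k)) :=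
    fun s => Finset.sum_congr rfl fun k _ => by ring
  rw [loadedDet, loadedDet, h', h', h, prod_eq_mul_mul_prod_erase hij]
  have hi := h0 i
  have hj := h0 j
  field_simp
  ring

end LoadedDet

/-! ### Transferring load between unequal noise levels -/

section Transfer

variable {n : ℕ} {b s : Fin n → ℝ}

/-- The factor of `loadedDet b s` that involves the coordinates `i`, `j` and the load. -/
noncomputable def pairFactor (b s : Fin n → ℝ) (i j : Fin n) (τ : ℝ) : ℝ :=
  (1 + τ * b i) * (1 + τ * b j) * (1 + ∑ k, τ * s k / (1 + τ * b k))

theorem loadedDet_eq_mul_pairFactor (b s : Fin n → ℝ) {i j : Fin n} (hij : i ≠ j) (τ : ℝ) :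
    loadedDet b s τ
      = (∏ k ∈ (Finset.univ.erase i).erase j, (1 + τ * b k)) * pairFactor b s i j τ := by
  rw [loadedDet, prod_eq_mul_mul_prod_erase hij, pairFactor]
  ring

theorem pairFactor_mono (hb : ∀ k, 0 ≤ b k) (hs : ∀ k, 0 ≤ s k) (i j : Fin n) {x y : ℝ}
    (hx : 0 ≤ x) (hxy : x ≤ y) : pairFactor b s i j x ≤ pairFactor b s i j y := by
  have hy := hx.trans hxy
  have hnn : ∀ k, 0 ≤ x * b k := fun k => mul_nonneg hx (hb k)
  have hle : ∀ k, x * b k ≤ y * b k := fun k => mul_le_mul_of_nonneg_right hxy (hb k)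
  have h1 : ∑ k, x * s k / (1 + x * b k) ≤ ∑ k, y * s k / (1 + y * b k) := by
    refine Finset.sum_le_sum fun k _ => ?_
    have h2 := hnn k
    have h3 := hle k
    rw [div_le_div_iff₀ (by linarith) (by linarith)]
    nlinarith [mul_le_mul_of_nonneg_right hxy (hs k)]
  have h4 : 0 ≤ ∑ k, x * s k / (1 + x * b k) := Finset.sum_nonneg fun k _ => by
    have := hnn k
    have := mul_nonneg hx (hs k)
    positivity
  have := hnn i
  have := hnn j
  have := hle i
  have := hle j
  unfold pairFactor
  have h5 : (1 + x * b i) * (1 + x * b j) ≤ (1 + y * b i) * (1 + y * b j) := by nlinarith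
  have h6 : 0 ≤ (1 + x * b i) * (1 + x * b j) := by positivity
  exact mul_le_mul h5 (by linarith) (by linarith) (h6.trans h5)

/-- Makes the reciprocal of `pairFactor` tend to zero at infinity once coordinate `i` is loaded. -/
theorem one_add_mul_le_pairFactor (hb : ∀ k, 0 ≤ b k) (hs : ∀ k, 0 ≤ s k) (i j : Fin n) {x : ℝ}
    (hx : 0 ≤ x) : 1 + x * s i ≤ pairFactor b s i j x := by
  have hnn : ∀ k, 0 ≤ x * b k := fun k => mul_nonneg hx (hb k)
  have h1 : x * s i / (1 + x * b i) ≤ ∑ k, x * s k / (1 + x * b k) :=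
    Finset.single_le_sum (f := fun k => x * s k / (1 + x * b k)) (fun k _ => by
      have := hnn k
      have := mul_nonneg hx (hs k)
      positivity) (Finset.mem_univ i)
  have hi := hnn i
  have hj := hnn j
  have hsi := mul_nonneg hx (hs i)
  have h2 : 1 + x * s i ≤ (1 + x * b i) * (1 + ∑ k, x * s k / (1 + x * b k)) := by
    have := mul_le_mul_of_nonneg_left h1 (show 0 ≤ 1 + x * b i by linarith)
    rw [mul_div_cancel₀ _ (show 1 + x * b i ≠ 0 by linarith)] at this
    nlinarith
  unfold pairFactor
  nlinarith

/-- Freezing the argument at `max τ 0` avoids the poles at negative `τ` and gives a function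
continuous on the whole line. -/
theorem continuous_pairFactor_max (hb : ∀ k, 0 ≤ b k) (s : Fin n → ℝ) (i j : Fin n) :
    Continuous fun τ : ℝ => pairFactor b s i j (max τ 0) := by
  have h : ∀ k, Continuous fun τ : ℝ => max τ 0 * s k / (1 + max τ 0 * b k) := fun k =>
    Continuous.div (by fun_prop) (by fun_prop) fun τ => by
      have := mul_nonneg (le_max_right τ 0) (hb k)
      linarith
  unfold pairFactor
  fun_prop

theorem differentiableAt_pairFactor (hb : ∀ k, 0 ≤ b k) (s : Fin n → ℝ) (i j : Fin n) {τ : ℝ}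
    (hτ : 0 < τ) : DifferentiableAt ℝ (pairFactor b s i j) τ := by
  have h : ∀ k ∈ Finset.univ, DifferentiableAt ℝ (fun τ : ℝ => τ * s k / (1 + τ * b k)) τ :=
    fun k _ => DifferentiableAt.div (by fun_prop) (by fun_prop) (by
      have := mul_nonneg hτ.le (hb k)
      linarith)
  have := DifferentiableAt.fun_sum h
  unfold pairFactor
  fun_prop

/-- The derivative at `t = 0` of `loadedDet b (transfer s i j t) τ`. -/
noncomputable def transferSlope (b : Fin n → ℝ) (i j : Fin n) (τ : ℝ) : ℝ :=
  τ ^ 2 * (b j - b i) * ∏ k ∈ (Finset.univ.erase i).erase j, (1 + τ * b k)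

/-- Let `N` be the product over the other coordinates, `L = 1/pairFactor` and `w = exp (-τ)/N`. On
the positive axis `loadedDet = N/L` and the slope is `τ² (b j - b i) N`. The integrands become `(b j
- b i) τ L² w` and `(b j - b i)² τ³ L³ w`, so `sq_integral_lt_two_mul_integral` applies. -/
theorem sq_integral_transferSlope_lt (hb : ∀ k, 0 ≤ b k) (hs : ∀ k, 0 ≤ s k) {i j : Fin n}
    (hij : b i ≠ b j) (hi : 0 < s i) :
    IntegrableOn (fun τ => τ⁻¹ * (Real.exp (-τ) * (transferSlope b i j τ / loadedDet b s τ ^ 2)))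
      (Set.Ioi 0) ∧
    IntegrableOn
      (fun τ => τ⁻¹ * (Real.exp (-τ) * (transferSlope b i j τ ^ 2 / loadedDet b s τ ^ 3)))
      (Set.Ioi 0) ∧
    (∫ τ in Set.Ioi 0, τ⁻¹ * (Real.exp (-τ) * (transferSlope b i j τ / loadedDet b s τ ^ 2))) ^ 2
      < 2 * ∫ τ in Set.Ioi 0,
        τ⁻¹ * (Real.exp (-τ) * (transferSlope b i j τ ^ 2 / loadedDet b s τ ^ 3)) := by
  have hne : i ≠ j := fun h => hij (h ▸ rfl)
  let N : ℝ → ℝ := fun τ => ∏ k ∈ (Finset.univ.erase i).erase j, (1 + max τ 0 * b k)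
  let L : ℝ → ℝ := fun τ => (pairFactor b s i j (max τ 0))⁻¹
  let w : ℝ → ℝ := fun τ => Real.exp (-τ) * (N τ)⁻¹
  have hN1 : ∀ τ, 1 ≤ N τ := fun τ => Finset.one_le_prod fun k _ => by
    have := mul_nonneg (le_max_right τ 0) (hb k)
    linarith
  have hQ : ∀ τ, 1 + max τ 0 * s i ≤ pairFactor b s i j (max τ 0) := fun τ =>
    one_add_mul_le_pairFactor hb hs i j (le_max_right _ _)
  have hQ1 : ∀ τ, 1 ≤ pairFactor b s i j (max τ 0) := fun τ => by
    have := mul_nonneg (le_max_right τ 0) (hs i)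
    linarith [hQ τ]
  have hNc : Continuous N := by fun_prop
  have hLc : Continuous L := (continuous_pairFactor_max hb s i j).inv₀ fun τ => by
    linarith [hQ1 τ]
  have hwc : Continuous w :=
    Continuous.mul (by fun_prop) (hNc.inv₀ fun τ => by linarith [hN1 τ])
  have hL0 : ∀ τ, 0 < L τ := fun τ => inv_pos.2 (by linarith [hQ1 τ])
  have hL1 : ∀ τ, L τ ≤ 1 := fun τ => inv_le_one_of_one_le₀ (hQ1 τ)
  have hLanti : Antitone L := fun x y hxy => inv_anti₀ (by linarith [hQ1 x])
    (pairFactor_mono hb hs i j (le_max_right _ _) (max_le_max_right 0 hxy))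
  have hLd : ∀ τ, 0 < τ → HasDerivAt L (deriv L τ) τ := fun τ hτ => by
    have h1 : DifferentiableAt ℝ (fun τ => (pairFactor b s i j τ)⁻¹) τ :=
      (differentiableAt_pairFactor hb s i j hτ).inv (by
        have := hQ1 τ
        rw [max_eq_left hτ.le] at this
        linarith)
    refine (h1.congr_of_eventuallyEq ?_).hasDerivAt
    filter_upwards [Ioi_mem_nhds hτ] with x hx
    simp only [L, max_eq_left (le_of_lt (show (0 : ℝ) < x from hx))]
  have hLlim : Filter.Tendsto L Filter.atTop (nhds 0) := by
    refine Filter.Tendsto.inv_tendsto_atTop (Filter.tendsto_atTop_mono' _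
      (f₁ := fun τ => τ * s i) ?_ (Filter.tendsto_id.atTop_mul_const hi))
    filter_upwards with τ
    have := mul_le_mul_of_nonneg_right (le_max_left τ 0) hi.le
    linarith [hQ τ]
  have hw0 : ∀ τ, 0 < w τ := fun τ =>
    mul_pos (Real.exp_pos _) (inv_pos.2 (by linarith [hN1 τ]))
  have hwexp : ∀ τ, w τ ≤ Real.exp (-τ) := fun τ =>
    mul_le_of_le_one_right (Real.exp_pos _).le (inv_le_one_of_one_le₀ (hN1 τ))
  have key := sq_integral_lt_two_mul_integral hLc (fun τ _ => hL0 τ) (fun τ _ => hL1 τ) hLd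
    (fun τ _ => hLanti.deriv_nonpos) hLlim hwc (fun τ _ => hw0 τ) (fun τ _ => hwexp τ)
  have hLw : ∀ k τ, L τ ^ k * w τ ≤ Real.exp (-τ) := fun k τ =>
    (mul_le_of_le_one_left (hw0 τ).le (pow_le_one₀ (hL0 τ).le (hL1 τ))).trans (hwexp τ)
  have hLw0 : ∀ k τ, 0 ≤ L τ ^ k * w τ := fun k τ =>
    (mul_pos (pow_pos (hL0 τ) k) (hw0 τ)).le
  have hi1 : IntegrableOn (fun τ => τ * L τ ^ 2 * w τ) (Set.Ioi 0) := by
    simpa [mul_assoc] using integrableOn_pow_mul_of_le_exp_neg 1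
      (f := fun τ => L τ ^ 2 * w τ) (by fun_prop) (fun τ _ => hLw0 2 τ) (fun τ _ => hLw 2 τ)
  have hi2 : IntegrableOn (fun τ => τ ^ 3 * L τ ^ 3 * w τ) (Set.Ioi 0) := by
    simpa [mul_assoc] using integrableOn_pow_mul_of_le_exp_neg 3
      (f := fun τ => L τ ^ 3 * w τ) (by fun_prop) (fun τ _ => hLw0 3 τ) (fun τ _ => hLw 3 τ)
  have hD : ∀ τ, 0 < τ → loadedDet b s τ = N τ * (L τ)⁻¹ := fun τ hτ => by
    simp only [N, L, inv_inv, max_eq_left hτ.le]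
    exact loadedDet_eq_mul_pairFactor b s hne τ
  have hδ : ∀ τ, 0 < τ → transferSlope b i j τ = τ ^ 2 * (b j - b i) * N τ := fun τ hτ => by
    simp only [N, max_eq_left hτ.le, transferSlope]
  have e1 : ∀ τ ∈ Set.Ioi (0 : ℝ), (b j - b i) * (τ * L τ ^ 2 * w τ)
      = τ⁻¹ * (Real.exp (-τ) * (transferSlope b i j τ / loadedDet b s τ ^ 2)) := fun τ hτ => by
    have h0 : (0 : ℝ) < τ := hτ
    have h1 := hL0 τ
    have h2 : 0 < N τ := by linarith [hN1 τ]
    rw [hD τ h0, hδ τ h0]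
    simp only [w]
    field_simp
  have e2 : ∀ τ ∈ Set.Ioi (0 : ℝ), (b j - b i) ^ 2 * (τ ^ 3 * L τ ^ 3 * w τ)
      = τ⁻¹ * (Real.exp (-τ) * (transferSlope b i j τ ^ 2 / loadedDet b s τ ^ 3)) := fun τ hτ => by
    have h0 : (0 : ℝ) < τ := hτ
    have h1 := hL0 τ
    have h2 : 0 < N τ := by linarith [hN1 τ]
    rw [hD τ h0, hδ τ h0]
    simp only [w]
    field_simp
  refine ⟨IntegrableOn.congr_fun (hi1.const_mul _) e1 measurableSet_Ioi,
    IntegrableOn.congr_fun (hi2.const_mul _) e2 measurableSet_Ioi, ?_⟩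
  rw [← setIntegral_congr_fun measurableSet_Ioi e1, ← setIntegral_congr_fun measurableSet_Ioi e2,
    integral_const_mul, integral_const_mul, mul_pow]
  have : 0 < (b j - b i) ^ 2 := by
    have := sub_ne_zero.2 hij.symm
    positivity
  nlinarith

/-- The reciprocal is convex and lies above its tangent at `D`. -/
theorem inv_sub_inv_add_le {D x : ℝ} (hD : 0 < D) (hx : 0 < D + x) :
    D⁻¹ - (D + x)⁻¹ ≤ x / D ^ 2 := by
  have : x / D ^ 2 - (D⁻¹ - (D + x)⁻¹) = x ^ 2 / (D ^ 2 * (D + x)) := by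
    field_simp
    ring
  have h : 0 ≤ x ^ 2 / (D ^ 2 * (D + x)) := by positivity
  linarith

theorem two_inv_sub_inv_add_sub_inv_sub_le {D x : ℝ} (hD : 0 < D) (hx : 0 < D + x)
    (hx' : 0 < D - x) :
    (D⁻¹ - (D + x)⁻¹) + (D⁻¹ - (D - x)⁻¹) ≤ -(2 * (x ^ 2 / D ^ 3)) := by
  have : -(2 * (x ^ 2 / D ^ 3)) - ((D⁻¹ - (D + x)⁻¹) + (D⁻¹ - (D - x)⁻¹))
      = 2 * x ^ 4 / (D ^ 3 * ((D + x) * (D - x))) := by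
    field_simp
    ring
  have h : 0 ≤ 2 * x ^ 4 / (D ^ 3 * ((D + x) * (D - x))) := by positivity
  linarith

/-- A load spread over two unequal coordinates can be improved by moving some of it from one of
them to the other. -/
theorem exists_load_gt (hb : ∀ k, 0 ≤ b k) (hs : ∀ k, 0 ≤ s k) {i j : Fin n} (hij : b i ≠ b j)
    (hi : 0 < s i) (hj : 0 < s j) {α : ℝ} (hα : 0 < α) :
    ∃ s' : Fin n → ℝ, (∀ k, 0 ≤ s' k) ∧ ∑ k, s' k = ∑ k, s k ∧
      Real.log (1 + ∑ k, s k / (α + b k)) - loadedRate b s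
        < Real.log (1 + ∑ k, s' k / (α + b k)) - loadedRate b s' := by
  by_contra! hcon
  have hne : i ≠ j := fun h => hij (h ▸ rfl)
  obtain ⟨hI1, hI2, hlt⟩ := sq_integral_transferSlope_lt hb hs hij hi
  set I₁ := ∫ τ in Set.Ioi 0,
    τ⁻¹ * (Real.exp (-τ) * (transferSlope b i j τ / loadedDet b s τ ^ 2)) with hI₁
  set I₂ := ∫ τ in Set.Ioi 0,
    τ⁻¹ * (Real.exp (-τ) * (transferSlope b i j τ ^ 2 / loadedDet b s τ ^ 3)) with hI₂
  have hsum : ∀ {s' : Fin n → ℝ}, (∀ k, 0 ≤ s' k) → 0 < 1 + ∑ k, s' k / (α + b k) := fun hs' => by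
    have := Finset.sum_nonneg (s := Finset.univ) fun k _ =>
      div_nonneg (hs' k) (add_nonneg hα.le (hb k))
    linarith
  set F := 1 + ∑ k, s k / (α + b k) with hF
  have hFpos : 0 < F := hsum hs
  set r := ((α + b i)⁻¹ - (α + b j)⁻¹) / F with hr
  set t₀ := min (s i) (s j) with ht₀
  have habs : ∀ {t : ℝ}, |t| < t₀ → ∀ k, 0 ≤ transfer s i j t k := fun ht =>
    transfer_nonneg hs (ht.le.trans (min_le_left _ _)) (ht.le.trans (min_le_right _ _))
  -- `r` is the logarithmic derivative of the signal-to-noise term at `t = 0`.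
  have hFt : ∀ t, 1 + ∑ k, transfer s i j t k / (α + b k) = F * (1 + t * r) := fun t => by
    have := sum_transfer_mul s (fun k => (α + b k)⁻¹) i j t
    simp only [div_eq_mul_inv] at hF ⊢
    have hFr : F * r = (α + b i)⁻¹ - (α + b j)⁻¹ := mul_div_cancel₀ _ hFpos.ne'
    rw [this]
    linear_combination -hF - t * hFr
  have hpos : ∀ {t : ℝ}, |t| < t₀ → 0 < 1 + t * r := fun {t} ht => by
    have := hsum (habs ht)
    rw [hFt] at this
    exact pos_of_mul_pos_right this hFpos.le
  have hlog : ∀ {t : ℝ}, |t| < t₀ → Real.log (1 + t * r)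
      ≤ loadedRate b (transfer s i j t) - loadedRate b s := fun {t} ht => by
    have := hcon _ (habs ht) (sum_transfer s i j t)
    rw [hFt, Real.log_mul hFpos.ne' (hpos ht).ne'] at this
    linarith
  have hint : ∀ {t : ℝ}, |t| < t₀ → IntegrableOn (fun τ => τ⁻¹ * (Real.exp (-τ)
      * ((loadedDet b s τ)⁻¹ - (loadedDet b s τ + t * transferSlope b i j τ)⁻¹))) (Set.Ioi 0) ∧
      loadedRate b (transfer s i j t) - loadedRate b s = ∫ τ in Set.Ioi 0, τ⁻¹ * (Real.exp (-τ)
      * ((loadedDet b s τ)⁻¹ - (loadedDet b s τ + t * transferSlope b i j τ)⁻¹)) := fun {t} ht => by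
    have h1 := integrableOn_loadedRate hb (habs ht)
    have h2 := integrableOn_loadedRate hb hs
    have he : ∀ τ ∈ Set.Ioi (0 : ℝ),
        τ⁻¹ * (Real.exp (-τ) * (1 - (loadedDet b (transfer s i j t) τ)⁻¹))
          - τ⁻¹ * (Real.exp (-τ) * (1 - (loadedDet b s τ)⁻¹)) = τ⁻¹ * (Real.exp (-τ)
      * ((loadedDet b s τ)⁻¹ - (loadedDet b s τ + t * transferSlope b i j τ)⁻¹)) := fun τ hτ => by
      rw [loadedDet_transfer hb hne t (le_of_lt hτ), transferSlope]
      ring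
    refine ⟨IntegrableOn.congr_fun (h1.sub h2) he measurableSet_Ioi, ?_⟩
    rw [loadedRate, loadedRate, ← integral_sub h1 h2]
    exact setIntegral_congr_fun measurableSet_Ioi he
  have hDpos : ∀ {t : ℝ}, |t| < t₀ → ∀ τ ∈ Set.Ioi (0 : ℝ),
      0 < loadedDet b s τ + t * transferSlope b i j τ := fun {t} ht τ hτ => by
    have := one_le_loadedDet hb (habs ht) (le_of_lt hτ)
    rw [loadedDet_transfer hb hne t (le_of_lt hτ)] at this
    exact lt_of_lt_of_le one_pos this
  have hD : ∀ τ ∈ Set.Ioi (0 : ℝ), 0 < loadedDet b s τ := fun τ hτ =>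
    lt_of_lt_of_le one_pos (one_le_loadedDet hb hs (le_of_lt hτ))
  have hfirst : ∀ {t : ℝ}, |t| < t₀ → Real.log (1 + t * r) ≤ t * I₁ := fun {t} ht => by
    refine (hlog ht).trans ?_
    rw [(hint ht).2, hI₁, ← integral_const_mul]
    refine setIntegral_mono_on (hint ht).1 (hI1.const_mul t) measurableSet_Ioi fun τ hτ => ?_
    have h0 : (0 : ℝ) < τ := hτ
    have := mul_le_mul_of_nonneg_left (inv_sub_inv_add_le (hD τ hτ) (hDpos ht τ hτ))
      (show 0 ≤ τ⁻¹ * Real.exp (-τ) by positivity)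
    calc _ = _ := (mul_assoc _ _ _).symm
      _ ≤ _ := this
      _ = _ := by ring
  have hsecond : ∀ {t : ℝ}, |t| < t₀ →
      Real.log (1 + t * r) + Real.log (1 - t * r) ≤ -(2 * t ^ 2 * I₂) := fun {t} ht => by
    have ht' : |-t| < t₀ := by rwa [abs_neg]
    have h1 := add_le_add (hlog ht) (hlog ht')
    rw [neg_mul, ← sub_eq_add_neg] at h1
    refine h1.trans ?_
    rw [(hint ht).2, (hint ht').2, ← integral_add (hint ht).1 (hint ht').1, hI₂,
      ← neg_mul, ← integral_const_mul]
    refine setIntegral_mono_on ((hint ht).1.add (hint ht').1) (hI2.const_mul _)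
      measurableSet_Ioi fun τ hτ => ?_
    have h0 : (0 : ℝ) < τ := hτ
    have hm := hDpos ht' τ hτ
    rw [neg_mul, ← sub_eq_add_neg] at hm
    have := mul_le_mul_of_nonneg_left
      (two_inv_sub_inv_add_sub_inv_sub_le (hD τ hτ) (hDpos ht τ hτ) hm)
      (show 0 ≤ τ⁻¹ * Real.exp (-τ) by positivity)
    rw [neg_mul, ← sub_eq_add_neg]
    calc _ = _ := by ring
      _ ≤ _ := this
      _ = _ := by ring
  have hcoe : ∀ t, 0 < t → t < t₀ → |t| < t₀ := fun t h1 h2 => by rwa [abs_of_pos h1]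
  -- If no transfer helps, the first-order condition is `r = I₁` and the second-order one `2 I₂ ≤
  -- I₁²`, against `hlt`.
  have := two_mul_le_sq_of_log_le (lt_min hi hj) (r := r) (I₁ := I₁) (I₂ := I₂)
    (fun t h1 h2 => hpos (hcoe t h1 h2))
    (fun t h1 h2 => by
      have := hpos (t := -t) (by rw [abs_neg]; exact hcoe t h1 h2)
      linarith)
    (fun t h1 h2 => hfirst (hcoe t h1 h2))
    (fun t h1 h2 => by
      have := hfirst (t := -t) (by rw [abs_neg]; exact hcoe t h1 h2)
      rwa [neg_mul, neg_mul, ← sub_eq_add_neg] at this)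
    (fun t h1 h2 => hsecond (hcoe t h1 h2))
  linarith

end Transfer

/-! ### Rank-one signal with diagonal noise -/

section Loaded

variable {n : ℕ}

theorem posSemidef_diagonal_ofReal {b : Fin n → ℝ} (hb : ∀ k, 0 ≤ b k) :
    (diagonal fun k => (b k : ℂ)).PosSemidef :=
  PosSemidef.diagonal fun k => by simpa using hb k

/-- Factor out the diagonal part and apply the matrix determinant lemma to the rank-one remainder.
-/
theorem det_one_add_smul_diagonal_add_vecMulVec {b : Fin n → ℝ} (hb : ∀ k, 0 ≤ b k)
    (u : Fin n → ℂ) {τ : ℝ} (hτ : 0 ≤ τ) :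
    (1 + (τ : ℂ) • (vecMulVec u (star u) + diagonal fun k => (b k : ℂ))).det
      = (loadedDet b (fun k => Complex.normSq (u k)) τ : ℝ) := by
  have h0 : ∀ k, (1 + τ * b k : ℂ) ≠ 0 := fun k => by
    have := mul_nonneg hτ (hb k)
    exact_mod_cast (show (1 + τ * b k : ℝ) ≠ 0 by linarith)
  have hd : (1 : Matrix (Fin n) (Fin n) ℂ) + (τ : ℂ) • (vecMulVec u (star u)
      + diagonal fun k => (b k : ℂ)) = (diagonal fun k => (1 + τ * b k : ℂ)) *
      (1 + replicateCol Unit (fun k => τ * u k / (1 + τ * b k))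
        * replicateRow Unit (star u)) := by
    rw [Matrix.mul_add, Matrix.mul_one, ← vecMulVec_eq]
    ext i j
    have := h0 i
    by_cases hij : i = j
    · subst hij
      simp [vecMulVec_apply]
      field_simp
      ring
    · simp [vecMulVec_apply, hij]
      field_simp
  rw [hd, det_mul, det_diagonal, det_one_add_replicateCol_mul_replicateRow, loadedDet]
  push_cast
  congr 2
  refine Finset.sum_congr rfl fun k _ => ?_
  rw [Complex.normSq_eq_conj_mul_self, Pi.star_apply, Complex.star_def]
  ring

theorem ergodicRate_vecMulVec_add_diagonal {b : Fin n → ℝ} (hb : ∀ k, 0 ≤ b k)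
    (u : Fin n → ℂ) : ergodicRate (vecMulVec u (star u) + diagonal fun k => (b k : ℂ))
      = loadedRate b (fun k => Complex.normSq (u k)) := by
  rw [ergodicRate_eq_integral_det ((posSemidef_vecMulVec_self_star u).add
    (posSemidef_diagonal_ofReal hb)), loadedRate]
  refine setIntegral_congr_fun measurableSet_Ioi fun τ hτ => ?_
  simp only [det_one_add_smul_diagonal_add_vecMulVec hb u (le_of_lt hτ), Complex.ofReal_re]

theorem secrecyRate_vecMulVec_diagonal {b : Fin n → ℝ} (hb : ∀ k, 0 ≤ b k) (u x : Fin n → ℂ) :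
    secrecyRate (WithLp.toLp 2 x) (vecMulVec u (star u), diagonal fun k => (b k : ℂ))
      = max 0 (Real.log (1 + Complex.normSq (star u ⬝ᵥ x) / (1 + ∑ k, b k * Complex.normSq (x k)))
        - (loadedRate b (fun k => Complex.normSq (u k))
          - ergodicRate (diagonal fun k => (b k : ℂ)))) := by
  rw [secrecyRate_eq (posSemidef_vecMulVec_self_star u) (posSemidef_diagonal_ofReal hb)]
  simp only [quadForm_add, quadForm_vecMulVec, quadForm_diagonal,
    ergodicRate_vecMulVec_add_diagonal hb]
  have h1 : 0 < 1 + ∑ k, b k * Complex.normSq (x k) := by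
    have := Finset.sum_nonneg (s := Finset.univ) fun k _ =>
      mul_nonneg (hb k) (Complex.normSq_nonneg (x k))
    linarith
  have h2 := Complex.normSq_nonneg (star u ⬝ᵥ x)
  rw [← Real.log_div (by linarith) h1.ne']
  congr 4
  field_simp
  ring

/-- Absorbs the receiver noise `1 = α ‖x‖²` into the quadratic form, so the signal-to-noise ratio
becomes homogeneous in `x`. -/
theorem one_add_sum_eq {b : Fin n → ℝ} {x : Fin n → ℂ} (hx : 0 < ∑ k, Complex.normSq (x k)) :
    1 + ∑ k, b k * Complex.normSq (x k)
      = ∑ k, ((∑ k, Complex.normSq (x k))⁻¹ + b k) * Complex.normSq (x k) := by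
  simp_rw [add_mul, Finset.sum_add_distrib, ← Finset.mul_sum]
  rw [inv_mul_cancel₀ hx.ne']

/-- The direction that maximizes the signal to noise ratio attains the value
`uᴴ (α + diag b)⁻¹ u`. -/
theorem exists_matched_direction {b : Fin n → ℝ} (hb : ∀ k, 0 ≤ b k) {u : Fin n → ℂ} (hu : u ≠ 0)
    {p : ℝ} (hp : 0 < p) : ∃ x : Fin n → ℂ, ∑ k, Complex.normSq (x k) = p ∧
      Complex.normSq (star u ⬝ᵥ x) / (1 + ∑ k, b k * Complex.normSq (x k))
        = ∑ k, Complex.normSq (u k) / (p⁻¹ + b k) := by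
  have hβ : ∀ k, 0 < p⁻¹ + b k := fun k => add_pos_of_pos_of_nonneg (inv_pos.2 hp) (hb k)
  obtain ⟨j, hj⟩ := Function.ne_iff.1 hu
  have hj' : 0 < Complex.normSq (u j) := Complex.normSq_pos.2 hj
  have hpos : ∀ m : ℕ, 0 < ∑ k, Complex.normSq (u k) / (p⁻¹ + b k) ^ m := fun m =>
    Finset.sum_pos' (fun k _ => div_nonneg (Complex.normSq_nonneg _) (pow_pos (hβ k) m).le)
      ⟨j, Finset.mem_univ j, div_pos hj' (pow_pos (hβ j) m)⟩
  have hq : 0 < ∑ k, Complex.normSq (u k) / (p⁻¹ + b k) := by simpa using hpos 1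
  set q := ∑ k, Complex.normSq (u k) / (p⁻¹ + b k) with hqdef
  set m := ∑ k, Complex.normSq (u k) / (p⁻¹ + b k) ^ 2 with hm
  have hm0 : 0 < m := hpos 2
  -- The extremal direction is `(p⁻¹ + diag b)⁻¹ u`; `c` rescales it to squared norm `p`.
  set c := √(p / m) with hc
  have hc2 : c * c = p / m := Real.mul_self_sqrt (by positivity)
  have hn : ∀ k, Complex.normSq ((c : ℂ) * (u k / ((p⁻¹ + b k : ℝ) : ℂ)))
      = c * c * (Complex.normSq (u k) / (p⁻¹ + b k) ^ 2) := fun k => by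
    rw [Complex.normSq_mul, Complex.normSq_div, Complex.normSq_ofReal, Complex.normSq_ofReal,
      sq]
  have hsum : ∑ k, Complex.normSq ((c : ℂ) * (u k / ((p⁻¹ + b k : ℝ) : ℂ))) = p := by
    simp_rw [hn, ← Finset.mul_sum]
    rw [hc2, ← hm, div_mul_cancel₀ _ hm0.ne']
  refine ⟨fun k => (c : ℂ) * (u k / ((p⁻¹ + b k : ℝ) : ℂ)), hsum, ?_⟩
  have hin : star u ⬝ᵥ (fun k => (c : ℂ) * (u k / ((p⁻¹ + b k : ℝ) : ℂ))) = ((c * q : ℝ) : ℂ) := by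
    rw [hqdef, dotProduct]
    push_cast
    rw [Finset.mul_sum]
    refine Finset.sum_congr rfl fun k _ => ?_
    rw [Complex.normSq_eq_conj_mul_self, Pi.star_apply, Complex.star_def]
    ring
  have hden : 1 + ∑ k, b k * Complex.normSq ((c : ℂ) * (u k / ((p⁻¹ + b k : ℝ) : ℂ)))
      = c * c * q := by
    rw [one_add_sum_eq (by rw [hsum]; exact hp), hsum, hqdef, Finset.mul_sum]
    refine Finset.sum_congr rfl fun k _ => ?_
    rw [hn]
    have := hβ k
    field_simp
  have hcpos : 0 < c * c := by rw [hc2]; positivity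
  rw [hin, hden, Complex.normSq_ofReal, div_eq_iff (by positivity)]
  ring

/-- Pythagoras for the inner product weighted by `β`: the subtracted vector is the projection of `x`
onto the line through `β⁻¹ u`. -/
theorem sum_mul_normSq_sub {β : Fin n → ℝ} (hβ : ∀ k, 0 < β k) (u x : Fin n → ℂ)
    (hq : (∑ k, Complex.normSq (u k) / β k) ≠ 0) :
    ∑ k, β k * Complex.normSq (x k
        - (star u ⬝ᵥ x) / ((∑ k, Complex.normSq (u k) / β k : ℝ) : ℂ) * (u k / (β k : ℂ)))
      = ∑ k, β k * Complex.normSq (x k)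
        - Complex.normSq (star u ⬝ᵥ x) / ∑ k, Complex.normSq (u k) / β k := by
  set q := ∑ k, Complex.normSq (u k) / β k with hqdef
  set z := star u ⬝ᵥ x with hz
  have h1 : ∀ k, β k * Complex.normSq (x k - z / (q : ℂ) * (u k / (β k : ℂ)))
      = β k * Complex.normSq (x k) + Complex.normSq z / q ^ 2 * (Complex.normSq (u k) / β k)
        - 2 / q * (z * (u k * (starRingEnd ℂ) (x k))).re := fun k => by
    have h2 : z / (q : ℂ) * (u k / (β k : ℂ)) = ((q⁻¹ * (β k)⁻¹ : ℝ) : ℂ) * (z * u k) := by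
      push_cast; ring
    have h3 : (x k * (starRingEnd ℂ) (((q⁻¹ * (β k)⁻¹ : ℝ) : ℂ) * (z * u k))).re
        = q⁻¹ * (β k)⁻¹ * (z * (u k * (starRingEnd ℂ) (x k))).re := by
      rw [map_mul, Complex.conj_ofReal, mul_left_comm, Complex.re_ofReal_mul,
        ← Complex.conj_re (x k * _)]
      congr 2
      simp
      ring
    have := hβ k
    rw [h2, Complex.normSq_sub, h3, Complex.normSq_mul, Complex.normSq_ofReal, Complex.normSq_mul]
    field_simp
  simp_rw [h1]
  rw [Finset.sum_sub_distrib, Finset.sum_add_distrib, ← Finset.mul_sum, ← Finset.mul_sum,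
    ← Complex.re_sum, ← Finset.mul_sum, ← hqdef]
  have h4 : ∑ k, u k * (starRingEnd ℂ) (x k) = (starRingEnd ℂ) z := by
    rw [hz, dotProduct, map_sum]
    refine Finset.sum_congr rfl fun k _ => ?_
    simp
  rw [h4, Complex.mul_conj, Complex.ofReal_re]
  field_simp
  ring

/-- Cauchy-Schwarz in the weights `α + b k`, with its equality case: the residual of the projection
must vanish. -/
theorem normSq_dotProduct_le_and_eq {b : Fin n → ℝ} (hb : ∀ k, 0 ≤ b k) {u : Fin n → ℂ}
    (hu : u ≠ 0) {x : Fin n → ℂ} (hx : 0 < ∑ k, Complex.normSq (x k)) :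
    let α := (∑ k, Complex.normSq (x k))⁻¹
    let q := ∑ k, Complex.normSq (u k) / (α + b k)
    let v := Complex.normSq (star u ⬝ᵥ x) / (1 + ∑ k, b k * Complex.normSq (x k))
    v ≤ q ∧ (v = q → ∃ c : ℂ, ∀ k, x k = c * (u k / ((α + b k : ℝ) : ℂ))) := by
  intro α q v
  have hα : 0 < α := inv_pos.2 hx
  have hβ : ∀ k, 0 < α + b k := fun k => add_pos_of_pos_of_nonneg hα (hb k)
  obtain ⟨j, hj⟩ := Function.ne_iff.1 hu
  have hj' : 0 < Complex.normSq (u j) := Complex.normSq_pos.2 hj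
  have hq : 0 < q := Finset.sum_pos' (fun k _ => div_nonneg (Complex.normSq_nonneg _) (hβ k).le)
    ⟨j, Finset.mem_univ j, div_pos hj' (hβ j)⟩
  have hE : 1 + ∑ k, b k * Complex.normSq (x k) = ∑ k, (α + b k) * Complex.normSq (x k) :=
    one_add_sum_eq hx
  have hEpos : 0 < 1 + ∑ k, b k * Complex.normSq (x k) := by
    have := Finset.sum_nonneg (s := Finset.univ) fun k _ =>
      mul_nonneg (hb k) (Complex.normSq_nonneg (x k))
    linarith
  have key := sum_mul_normSq_sub hβ u x hq.ne'
  rw [← hE] at key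
  have hterm : ∀ k ∈ Finset.univ, 0 ≤ (α + b k) * Complex.normSq (x k
        - (star u ⬝ᵥ x) / ((∑ k, Complex.normSq (u k) / (α + b k) : ℝ) : ℂ)
          * (u k / ((α + b k : ℝ) : ℂ))) := fun k _ =>
    mul_nonneg (hβ k).le (Complex.normSq_nonneg _)
  have hnn := Finset.sum_nonneg hterm
  refine ⟨?_, fun hv => ⟨(star u ⬝ᵥ x) / (q : ℂ), fun k => ?_⟩⟩
  · rw [key, sub_nonneg, div_le_iff₀ hq] at hnn
    exact (div_le_iff₀ hEpos).2 (by linarith)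
  · have h0 : 1 + ∑ k, b k * Complex.normSq (x k) - Complex.normSq (star u ⬝ᵥ x) / q = 0 := by
      rw [(div_eq_iff hEpos.ne').1 hv]
      field_simp
      ring
    rw [h0, Finset.sum_eq_zero_iff_of_nonneg hterm] at key
    have := key k (Finset.mem_univ k)
    rcases mul_eq_zero.1 this with h | h
    · exact absurd h (hβ k).ne'
    · exact sub_eq_zero.1 (Complex.normSq_eq_zero.1 h)

theorem mem_feasibleSet_loaded {PT : ℝ} {b : Fin n → ℝ} (hb : ∀ k, 0 ≤ b k) {u : Fin n → ℂ}
    (hP : ∑ k, Complex.normSq (u k) + ∑ k, b k ≤ PT) :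
    (vecMulVec u (star u), diagonal fun k => (b k : ℂ)) ∈ feasibleSet n PT := by
  refine ⟨posSemidef_vecMulVec_self_star u, posSemidef_diagonal_ofReal hb, ?_⟩
  simp only [trace_add, trace_vecMulVec, trace_diagonal, ← sum_normSq_eq, Complex.add_re,
    Complex.ofReal_re, Complex.re_sum]
  exact hP

/-- The signal direction of an optimal pair is aligned with the channel, in coordinates that
diagonalize the artificial noise covariance. -/
theorem aligned_of_optimal_loaded {PT : ℝ} {b : Fin n → ℝ} (hb : ∀ k, 0 ≤ b k) {u h : Fin n → ℂ}
    (hh : 0 < ∑ k, Complex.normSq (h k)) (hP : ∑ k, Complex.normSq (u k) + ∑ k, b k ≤ PT)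
    (hpos : 0 < secrecyRate (WithLp.toLp 2 h) (vecMulVec u (star u), diagonal fun k => (b k : ℂ)))
    (hopt : ∀ x : Fin n → ℂ, ∑ k, Complex.normSq (x k) = ∑ k, Complex.normSq (h k) →
      ∀ T ∈ feasibleSet n PT, secrecyRate (WithLp.toLp 2 x) T
        ≤ secrecyRate (WithLp.toLp 2 h) (vecMulVec u (star u), diagonal fun k => (b k : ℂ))) :
    ∃ c : ℂ, u = c • h := by
  by_cases hu : u = 0
  · exact ⟨0, by simp [hu]⟩
  set p := ∑ k, Complex.normSq (h k) with hp
  set s : Fin n → ℝ := fun k => Complex.normSq (u k) with hs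
  have hs0 : ∀ k, 0 ≤ s k := fun k => Complex.normSq_nonneg _
  have hβ : ∀ k, 0 < p⁻¹ + b k := fun k => add_pos_of_pos_of_nonneg (inv_pos.2 hh) (hb k)
  set G := ergodicRate (diagonal fun k => (b k : ℂ)) with hG
  set v := Complex.normSq (star u ⬝ᵥ h) / (1 + ∑ k, b k * Complex.normSq (h k)) with hv
  obtain ⟨hvq, heq⟩ := normSq_dotProduct_le_and_eq hb hu hh
  rw [← hp, ← hv] at hvq heq
  -- Compare with the signal `w` on its own matched channel, which `hopt` permits; positivity of the
  -- optimal rate removes the truncation at zero.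
  have hbound : ∀ w : Fin n → ℂ, w ≠ 0 → ∑ k, Complex.normSq (w k) = ∑ k, s k →
      Real.log (1 + ∑ k, Complex.normSq (w k) / (p⁻¹ + b k))
        - loadedRate b (fun k => Complex.normSq (w k))
      ≤ Real.log (1 + v) - loadedRate b s := fun w hw hws => by
    obtain ⟨x, hx, hxv⟩ := exists_matched_direction hb hw hh
    have h1 := hopt x hx _ (mem_feasibleSet_loaded (u := w) hb (by rw [hws]; exact hP))
    rw [secrecyRate_vecMulVec_diagonal hb, secrecyRate_vecMulVec_diagonal hb, hxv] at h1
    rw [secrecyRate_vecMulVec_diagonal hb] at hpos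
    have h2 : 0 < Real.log (1 + v) - (loadedRate b s - G) := by
      rcases lt_max_iff.1 hpos with h | h
      · exact absurd h (lt_irrefl _)
      · exact h
    rw [← hv, ← hs, ← hG, max_eq_right h2.le] at h1
    have := (le_max_right _ _).trans h1
    linarith
  have hv0 : 0 ≤ v := by
    have := Finset.sum_nonneg (s := Finset.univ) fun k _ =>
      mul_nonneg (hb k) (Complex.normSq_nonneg (h k))
    exact div_nonneg (Complex.normSq_nonneg _) (by linarith)
  -- Taking `w = u` shows that the actual channel is already matched to `u`.
  have hqv : v = ∑ k, Complex.normSq (u k) / (p⁻¹ + b k) := by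
    refine le_antisymm hvq ?_
    have h1 := hbound u hu rfl
    have h2 : Real.log (1 + ∑ k, Complex.normSq (u k) / (p⁻¹ + b k)) ≤ Real.log (1 + v) := by
      linarith
    have := (Real.log_le_log_iff (by linarith) (by linarith)).1 h2
    linarith
  obtain ⟨c, hc⟩ := heq hqv
  obtain ⟨j, hj⟩ := Function.ne_iff.1 hu
  have hj' : u j ≠ 0 := hj
  -- An improving load would contradict `hbound`. Only the moduli of the entries matter, so square
  -- roots of `s'` serve as the competing signal.
  have hsame : ∀ i, u i ≠ 0 → b i = b j := fun i hi => by
    by_contra hij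
    obtain ⟨s', hs', hsum, hlt⟩ := exists_load_gt hb hs0 hij (Complex.normSq_pos.2 hi)
      (Complex.normSq_pos.2 hj') (inv_pos.2 hh)
    have hw : ∀ k, Complex.normSq ((√(s' k) : ℝ) : ℂ) = s' k := fun k => by
      rw [Complex.normSq_ofReal, Real.mul_self_sqrt (hs' k)]
    have hne : (fun k => ((√(s' k) : ℝ) : ℂ)) ≠ 0 := fun h0 => by
      have h1 : ∑ k, s' k = 0 := Finset.sum_eq_zero fun k _ => by
        have := congr_fun h0 k
        rw [← hw k, this]
        simp
      rw [h1] at hsum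
      have h2 := Finset.single_le_sum (fun k _ => hs0 k) (Finset.mem_univ j)
      have h3 : 0 < s j := Complex.normSq_pos.2 hj'
      linarith
    have := hbound _ hne (by simp_rw [hw]; exact hsum)
    simp_rw [hw] at this
    rw [hqv] at this
    linarith
  -- On the support of `u` the weights `p⁻¹ + b k` are constant, so the matched direction is
  -- parallel to `u`.
  have hcoll : ∀ k, h k = c / ((p⁻¹ + b j : ℝ) : ℂ) * u k := fun k => by
    rw [hc k]
    by_cases hk : u k = 0
    · simp [hk]
    · rw [hsame k hk]; ring
  have hc0 : c / ((p⁻¹ + b j : ℝ) : ℂ) ≠ 0 := fun h0 => by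
    have : p = 0 := by
      rw [hp]
      exact Finset.sum_eq_zero fun k _ => by rw [hcoll k, h0]; simp
    linarith
  refine ⟨(c / ((p⁻¹ + b j : ℝ) : ℂ))⁻¹, funext fun k => ?_⟩
  rw [Pi.smul_apply, smul_eq_mul, hcoll k, inv_mul_cancel_left₀ hc0]

end Loaded

/-! ### Unitary invariance of the optimization problem -/

section Rotation

variable {n : ℕ}

/-- Extend `y` to an orthonormal basis with `y` at index `i`, and use its vectors as columns. -/
theorem exists_unitary_mulVec_single {y : Fin n → ℂ} (hy : ∑ k, Complex.normSq (y k) = 1)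
    (i : Fin n) : ∃ U ∈ unitaryGroup (Fin n) ℂ, U *ᵥ Pi.single i 1 = y := by
  have hv : Orthonormal ℂ (({i} : Set (Fin n)).domRestrict
      fun _ : Fin n => (WithLp.toLp 2 y : EuclideanSpace ℂ (Fin n))) := by
    refine ⟨fun _ => ?_, fun a b hab => absurd (Subsingleton.elim a b) hab⟩
    rw [Set.domRestrict_apply, EuclideanSpace.norm_eq, ← Real.sqrt_one, ← hy]
    simp [Complex.normSq_eq_norm_sq]
  obtain ⟨B, hB⟩ := hv.exists_orthonormalBasis_extension_of_card_eq (by simp)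
  refine ⟨_, (EuclideanSpace.basisFun (Fin n) ℂ).toMatrix_orthonormalBasis_mem_unitary B, ?_⟩
  ext k
  simp [Module.Basis.toMatrix_apply, hB i rfl]

theorem exists_unitary_mulVec_eq {x y : Fin n → ℂ} (hx : 0 < ∑ k, Complex.normSq (x k))
    (hxy : ∑ k, Complex.normSq (x k) = ∑ k, Complex.normSq (y k)) :
    ∃ U ∈ unitaryGroup (Fin n) ℂ, U *ᵥ x = y := by
  obtain ⟨i, -, -⟩ := Finset.exists_ne_zero_of_sum_ne_zero hx.ne'
  set p := ∑ k, Complex.normSq (x k) with hp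
  set c : ℂ := ((√p : ℝ) : ℂ) with hc
  have hc0 : c ≠ 0 := by
    rw [hc]; exact_mod_cast (Real.sqrt_pos.2 hx).ne'
  have hcn : Complex.normSq c = p := by
    rw [hc, Complex.normSq_ofReal, Real.mul_self_sqrt hx.le]
  have hunit : ∀ z : Fin n → ℂ, ∑ k, Complex.normSq (z k) = p →
      ∑ k, Complex.normSq ((c⁻¹ • z) k) = 1 := fun z hz => by
    simp only [Pi.smul_apply, smul_eq_mul, Complex.normSq_mul, Complex.normSq_inv,
      ← Finset.mul_sum, hcn, hz]
    exact inv_mul_cancel₀ hx.ne'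
  obtain ⟨V, hV, hVx⟩ := exists_unitary_mulVec_single (hunit x rfl) i
  obtain ⟨W, hW, hWy⟩ := exists_unitary_mulVec_single (hunit y hxy.symm) i
  have hx' : x = c • V *ᵥ Pi.single i 1 := by rw [hVx, smul_inv_smul₀ hc0]
  have hy' : y = c • W *ᵥ Pi.single i 1 := by rw [hWy, smul_inv_smul₀ hc0]
  refine ⟨W * Vᴴ, mul_mem hW (conjTranspose_mem_unitaryGroup hV), ?_⟩
  rw [hx', hy', mulVec_smul, mulVec_mulVec, Matrix.mul_assoc, ← star_eq_conjTranspose,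
    mem_unitaryGroup_iff'.1 hV, Matrix.mul_one]

theorem unitary_conj_mem_feasibleSet {PT : ℝ} {U : Matrix (Fin n) (Fin n) ℂ}
    (hU : U ∈ unitaryGroup (Fin n) ℂ)
    {T : Matrix (Fin n) (Fin n) ℂ × Matrix (Fin n) (Fin n) ℂ} (hT : T ∈ feasibleSet n PT) :
    (U * T.1 * Uᴴ, U * T.2 * Uᴴ) ∈ feasibleSet n PT := by
  refine ⟨posSemidef_unitary_conj hT.1 U, posSemidef_unitary_conj hT.2.1 U, ?_⟩
  rw [← Matrix.add_mul, ← Matrix.mul_add, trace_unitary_conj hU]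
  exact hT.2.2

theorem secrecyRate_unitary_conj {U : Matrix (Fin n) (Fin n) ℂ}
    (hU : U ∈ unitaryGroup (Fin n) ℂ)
    {T : Matrix (Fin n) (Fin n) ℂ × Matrix (Fin n) (Fin n) ℂ} (h1 : T.1.PosSemidef)
    (h2 : T.2.PosSemidef) (x : Fin n → ℂ) :
    secrecyRate (WithLp.toLp 2 (U *ᵥ x)) (U * T.1 * Uᴴ, U * T.2 * Uᴴ)
      = secrecyRate (WithLp.toLp 2 x) T := by
  have hx : Uᴴ *ᵥ (U *ᵥ x) = x := by
    rw [mulVec_mulVec, ← star_eq_conjTranspose, mem_unitaryGroup_iff'.1 hU, one_mulVec]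
  rw [secrecyRate_eq (posSemidef_unitary_conj h1 U) (posSemidef_unitary_conj h2 U),
    secrecyRate_eq h1 h2, ← Matrix.add_mul, ← Matrix.mul_add,
    ergodicRate_unitary_conj (h1.add h2) hU, ergodicRate_unitary_conj h2 hU]
  simp only [quadForm_conj, hx]

/-- An optimal pair for one channel direction dominates every pair for every channel direction
of the same norm. -/
theorem IsOptimalPair.secrecyRate_le {h : EuclideanSpace ℂ (Fin n)} {PT : ℝ}
    {S : Matrix (Fin n) (Fin n) ℂ × Matrix (Fin n) (Fin n) ℂ} (hS : IsOptimalPair h PT S)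
    {x : Fin n → ℂ} (hx : 0 < ∑ k, Complex.normSq (x k))
    (hxh : ∑ k, Complex.normSq (x k) = ∑ k, Complex.normSq (h k))
    {T : Matrix (Fin n) (Fin n) ℂ × Matrix (Fin n) (Fin n) ℂ} (hT : T ∈ feasibleSet n PT) :
    secrecyRate (WithLp.toLp 2 x) T ≤ secrecyRate h S := by
  obtain ⟨U, hU, hUx⟩ := exists_unitary_mulVec_eq (y := h.ofLp) hx hxh
  rw [← secrecyRate_unitary_conj hU hT.1 hT.2.1 x, hUx]
  exact hS.2 (unitary_conj_mem_feasibleSet hU hT)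

end Rotation

/-! ### The optimal signal covariance has rank at most one -/

section RankOne

variable {n : ℕ}

/-- A trace-free direction in which the signal covariance of an optimal pair can be moved both
ways is zero. -/
theorem quadForm_eq_zero_of_optimal {h : EuclideanSpace ℂ (Fin n)} {PT : ℝ}
    {S : Matrix (Fin n) (Fin n) ℂ × Matrix (Fin n) (Fin n) ℂ} (hS : IsOptimalPair h PT S)
    (hpos : 0 < secrecyRate h S) {D : Matrix (Fin n) (Fin n) ℂ} (hD : D.trace.re = 0)
    (hadd : (S.1 + D).PosSemidef) (hsub : (S.1 - D).PosSemidef) (g : Fin n → ℂ) :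
    quadForm D g = 0 := by
  obtain ⟨⟨h1, h2, h3⟩, hmax⟩ := hS
  set A := S.1 + S.2 with hA
  have hApos : A.PosSemidef := h1.add h2
  have hA1 : ∀ x, 0 < 1 + quadForm A x := fun x => by linarith [quadForm_nonneg hApos x]
  have hle : ∀ E : Matrix (Fin n) (Fin n) ℂ, E.trace.re = 0 → (S.1 + E).PosSemidef →
      (A + E).PosSemidef ∧ Real.log (1 + quadForm (A + E) h.ofLp) - Real.log (1 + quadForm A h.ofLp)
        ≤ ergodicRate (A + E) - ergodicRate A := fun E hE hSE => by
    have hAE : S.1 + E + S.2 = A + E := by rw [hA]; abel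
    have hf : (S.1 + E, S.2) ∈ feasibleSet n PT := by
      refine ⟨hSE, h2, ?_⟩
      simp only [hAE, trace_add, Complex.add_re, hE, add_zero]
      simpa [hA] using h3
    have hm : secrecyRate h (S.1 + E, S.2) ≤ secrecyRate h S := hmax hf
    rw [secrecyRate_eq (S := (S.1 + E, S.2)) hSE h2, secrecyRate_eq h1 h2] at hm
    rw [secrecyRate_eq h1 h2] at hpos
    simp only [hAE, ← hA] at hm hpos
    have h4 := (lt_max_iff.1 hpos).resolve_left (lt_irrefl _)
    rw [max_eq_right h4.le] at hm
    have := (le_max_right _ _).trans hm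
    exact ⟨hAE ▸ hSE.add h2, by linarith⟩
  obtain ⟨hp1, hl1⟩ := hle D hD hadd
  obtain ⟨hp2, hl2⟩ := hle (-D) (by simp [hD]) (by rwa [← sub_eq_add_neg])
  set Y : (Fin n → ℂ) → ℝ := fun x => quadForm D x / (1 + quadForm A x) with hY
  have hneg : ∀ x, quadForm (A + -D) x = quadForm A x - quadForm D x := fun x => by
    rw [← sub_eq_add_neg, quadForm_sub]
  have hY1 : ∀ x, 1 + quadForm (A + D) x = (1 + quadForm A x) * (1 + Y x) := fun x => by
    rw [quadForm_add, hY]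
    have := (hA1 x).ne'
    field_simp
    ring
  have hY2 : ∀ x, 1 + quadForm (A + -D) x = (1 + quadForm A x) * (1 - Y x) := fun x => by
    rw [hneg, hY]
    have := (hA1 x).ne'
    field_simp
    ring
  have hYp : ∀ x, 0 < 1 + Y x := fun x => by
    have : 0 < 1 + quadForm (A + D) x := by linarith [quadForm_nonneg hp1 x]
    rw [hY1] at this
    exact pos_of_mul_pos_right this (hA1 x).le
  have hYn : ∀ x, 0 < 1 - Y x := fun x => by
    have : 0 < 1 + quadForm (A + -D) x := by linarith [quadForm_nonneg hp2 x]
    rw [hY2] at this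
    exact pos_of_mul_pos_right this (hA1 x).le
  have hYc : Continuous Y := (continuous_quadForm D).div ((continuous_quadForm A).const_add 1)
    fun x => (hA1 x).ne'
  have hYi : Integrable Y (complexGaussianVector n) :=
    (integrable_const (1 : ℝ)).mono' hYc.aestronglyMeasurable (Filter.Eventually.of_forall fun x =>
      abs_le.2 ⟨by linarith [hYp x], by linarith [hYn x]⟩)
  set r := Y h.ofLp with hr
  have hrp : 0 < 1 + r := hYp _
  have hrn : 0 < 1 - r := hYn _
  have hlog : ∀ E : Matrix (Fin n) (Fin n) ℂ, (A + E).PosSemidef → ∀ Z : (Fin n → ℂ) → ℝ,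
      (∀ x, 0 < Z x) → (∀ x, 1 + quadForm (A + E) x = (1 + quadForm A x) * Z x) →
      Integrable (fun x => Real.log (Z x)) (complexGaussianVector n) ∧
      ergodicRate (A + E) - ergodicRate A = ∫ x, Real.log (Z x) ∂(complexGaussianVector n) :=
    fun E hE Z hZ hEZ => by
      have i1 := integrable_log_one_add_quadForm hE
      have i2 := integrable_log_one_add_quadForm hApos
      have he : ∀ x, Real.log (1 + quadForm (A + E) x) - Real.log (1 + quadForm A x)
          = Real.log (Z x) := fun x => by
        rw [hEZ, Real.log_mul (hA1 x).ne' (hZ x).ne', add_sub_cancel_left]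
      refine ⟨(i1.sub i2).congr (Filter.Eventually.of_forall he), ?_⟩
      rw [ergodicRate, ergodicRate, ← integral_sub i1 i2]
      exact integral_congr_ae (Filter.Eventually.of_forall he)
  obtain ⟨i1, e1⟩ := hlog D hp1 _ hYp hY1
  obtain ⟨i2, e2⟩ := hlog (-D) hp2 _ hYn hY2
  rw [e1, hY1, Real.log_mul (hA1 _).ne' hrp.ne', add_sub_cancel_left] at hl1
  rw [e2, hY2, Real.log_mul (hA1 _).ne' hrn.ne', add_sub_cancel_left] at hl2
  set m := ∫ x, Y x ∂(complexGaussianVector n) with hm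
  have hmean : ∀ a c : ℝ, Integrable (fun x => (a + c * Y x)) (complexGaussianVector n) ∧
      ∫ x, (a + c * Y x) ∂(complexGaussianVector n) = a + c * m := fun a c => by
    refine ⟨(integrable_const a).add (hYi.const_mul c), ?_⟩
    rw [integral_add (integrable_const a) (hYi.const_mul c), integral_const_mul]
    simp [hm]
  have hdiff : ∀ x, 0 ≤ ((Y x - r) / (1 + r)) - (Real.log (1 + Y x) - Real.log (1 + r)) := fun x => by
    have := Real.log_le_sub_one_of_pos (div_pos (hYp x) hrp)
    rw [Real.log_div (hYp x).ne' hrp.ne'] at this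
    have h5 : (1 + Y x) / (1 + r) - 1 = (Y x - r) / (1 + r) := by field_simp; ring
    linarith
  have hdiff2 : ∀ x, Real.log (1 - Y x) ≤ Real.log (1 - r) - (Y x - r) / (1 - r) := fun x => by
    have := Real.log_le_sub_one_of_pos (div_pos (hYn x) hrn)
    rw [Real.log_div (hYn x).ne' hrn.ne'] at this
    have h5 : (1 - Y x) / (1 - r) - 1 = -((Y x - r) / (1 - r)) := by field_simp; ring
    linarith
  -- The tangent bound for the logarithm at `1 - r`, averaged and set against optimality for `-D`.
  have hmr : m ≤ r := by
    have h6 : ∀ x, Real.log (1 - r) - (Y x - r) / (1 - r)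
        = (Real.log (1 - r) + r / (1 - r)) + (-(1 - r)⁻¹) * Y x := fun x => by ring
    have h7 := integral_mono i2 ((hmean _ _).1.congr
      (Filter.Eventually.of_forall fun x => (h6 x).symm)) hdiff2
    simp_rw [h6] at h7
    rw [(hmean _ _).2] at h7
    have h8 : 0 ≤ (r - m) / (1 - r) := by
      have : (r - m) / (1 - r) = r / (1 - r) + (-(1 - r)⁻¹) * m := by ring
      linarith
    have := mul_nonneg h8 hrn.le
    rw [div_mul_cancel₀ _ hrn.ne'] at this
    linarith
  -- With `m ≤ r`, the averaged tangent bound at `1 + r` and optimality for `D` squeeze a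
  -- nonnegative gap to mean zero. Strict concavity then gives `Y = r` almost everywhere.
  have hae : ∀ᵐ x ∂(complexGaussianVector n),
      ((Y x - r) / (1 + r)) - (Real.log (1 + Y x) - Real.log (1 + r)) = 0 := by
    have h6 : ∀ x, ((Y x - r) / (1 + r)) - (Real.log (1 + Y x) - Real.log (1 + r))
        = ((-r / (1 + r) + Real.log (1 + r)) + (1 + r)⁻¹ * Y x) - Real.log (1 + Y x) := fun x => by
      ring
    have hi : Integrable (fun x => ((Y x - r) / (1 + r)) - (Real.log (1 + Y x) - Real.log (1 + r)))
        (complexGaussianVector n) :=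
      ((hmean _ _).1.sub i1).congr (Filter.Eventually.of_forall fun x => (h6 x).symm)
    refine (integral_eq_zero_iff_of_nonneg hdiff hi).1 (le_antisymm ?_ (integral_nonneg hdiff))
    simp_rw [h6]
    rw [integral_sub (hmean _ _).1 i1, (hmean _ _).2]
    have h8 : (m - r) / (1 + r) ≤ 0 := div_nonpos_of_nonpos_of_nonneg (by linarith) hrp.le
    have : (m - r) / (1 + r) = -r / (1 + r) + (1 + r)⁻¹ * m := by ring
    linarith
  have hae2 : Y =ᵐ[complexGaussianVector n] fun _ => r := by
    filter_upwards [hae] with x hx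
    by_contra hne
    have hq1 : (1 + Y x) / (1 + r) ≠ 1 := fun h9 => hne (by
      rw [div_eq_one_iff_eq hrp.ne'] at h9; linarith)
    have := Real.log_lt_sub_one_of_pos (div_pos (hYp x) hrp) hq1
    rw [Real.log_div (hYp x).ne' hrp.ne'] at this
    have h5 : (1 + Y x) / (1 + r) - 1 = (Y x - r) / (1 + r) := by field_simp; ring
    linarith
  -- The Gaussian law charges every open set, so the continuous `Y` equals `r` everywhere;
  -- evaluating at the origin gives `r = 0`.
  have hall := (Continuous.ae_eq_iff_eq _ hYc continuous_const).1 hae2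
  have hr0 : r = 0 := by
    rw [← congr_fun hall 0]
    simp [hY, quadForm]
  have := congr_fun hall g
  rw [hr0] at this
  exact (div_eq_zero_iff.1 this).resolve_right (hA1 g).ne'

theorem vecMulVec_mulVec_star (U : Matrix (Fin n) (Fin n) ℂ) (v : Fin n → ℂ) :
    vecMulVec (U *ᵥ v) (star (U *ᵥ v)) = U * vecMulVec v (star v) * Uᴴ := by
  rw [star_mulVec, mul_vecMulVec, vecMulVec_mul]

/-- With two positive eigenvalues, the smaller amount could be shifted between them in either
direction. The resulting `D` has a nonzero quadratic form at an eigenvector, contradicting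
`quadForm_eq_zero_of_optimal`. -/
theorem exists_eq_vecMulVec_of_optimal {h : EuclideanSpace ℂ (Fin n)} {PT : ℝ}
    {S : Matrix (Fin n) (Fin n) ℂ × Matrix (Fin n) (Fin n) ℂ} (hS : IsOptimalPair h PT S)
    (hpos : 0 < secrecyRate h S) : ∃ u : Fin n → ℂ, S.1 = vecMulVec u (star u) := by
  obtain ⟨U, hU, a, ha, hUa⟩ := hS.1.1.exists_unitary_diagonal
  have hone : ∀ i j, 0 < a i → 0 < a j → i = j := fun i j hi hj => by
    by_contra hij
    set t := min (a i) (a j) with ht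
    have ht0 : 0 < t := lt_min hi hj
    have hti : |t| ≤ a i := by rw [abs_of_pos ht0]; exact min_le_left _ _
    have htj : |t| ≤ a j := by rw [abs_of_pos ht0]; exact min_le_right _ _
    set d : Fin n → ℝ := Pi.single i t - Pi.single j t with hd
    set D := U * diagonal (fun k => (d k : ℂ)) * Uᴴ with hDdef
    have hadd : S.1 + D = U * diagonal (fun k => (transfer a i j t k : ℂ)) * Uᴴ := by
      rw [hUa, hDdef, ← Matrix.add_mul, ← Matrix.mul_add, diagonal_add]
      simp [transfer, hd]
    have hsub : S.1 - D = U * diagonal (fun k => (transfer a i j (-t) k : ℂ)) * Uᴴ := by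
      rw [hUa, hDdef, ← Matrix.sub_mul, ← Matrix.mul_sub, diagonal_sub]
      congr 3
      funext k
      simp only [transfer, hd, Pi.add_apply, Pi.sub_apply, Pi.single_neg, Pi.neg_apply]
      push_cast
      ring
    have h0 := quadForm_eq_zero_of_optimal hS hpos (D := D)
      (by
        rw [hDdef, trace_unitary_conj hU, trace_diagonal, ← Complex.ofReal_sum, Complex.ofReal_re]
        simp [hd])
      (by
        rw [hadd]
        exact posSemidef_unitary_conj (posSemidef_diagonal_ofReal (transfer_nonneg ha hti htj)) U)
      (by
        rw [hsub]
        exact posSemidef_unitary_conj (posSemidef_diagonal_ofReal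
          (transfer_nonneg ha (by rwa [abs_neg]) (by rwa [abs_neg]))) U)
      (U *ᵥ Pi.single i 1)
    rw [hDdef, quadForm_conj, mulVec_mulVec, ← star_eq_conjTranspose, mem_unitaryGroup_iff'.1 hU,
      one_mulVec, quadForm_diagonal, Finset.sum_eq_single i] at h0
    · simp [hd, hij] at h0
      linarith
    · intro k _ hk
      simp [hk]
    · simp
  by_cases hz : ∃ i, 0 < a i
  · obtain ⟨i, hi⟩ := hz
    refine ⟨U *ᵥ Pi.single i ((√(a i) : ℝ) : ℂ), ?_⟩
    rw [vecMulVec_mulVec_star, hUa]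
    congr 2
    ext j k
    rw [diagonal_apply, vecMulVec_apply, Pi.star_apply]
    by_cases hj : j = i
    · subst hj
      by_cases hk : j = k
      · subst hk
        simp only [Pi.single_eq_same, if_true, Complex.star_def, Complex.conj_ofReal]
        rw [← Complex.ofReal_mul, Real.mul_self_sqrt hi.le]
      · simp [hk]
    · have : a j = 0 := le_antisymm (not_lt.1 fun h => hj (hone j i h hi)) (ha j)
      simp [hj, this]
  · push Not at hz
    have : a = 0 := funext fun k => le_antisymm (hz k) (ha k)
    exact ⟨0, by rw [hUa, this]; simp⟩

end RankOne

/-! ### Existence of a maximizer -/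

section Existence

variable {n : ℕ}

theorem continuousOn_ergodicRate (PT : ℝ) :
    ContinuousOn (ergodicRate (n := n)) {S | S.PosSemidef ∧ S.trace.re ≤ PT} := by
  have : FirstCountableTopology (Matrix (Fin n) (Fin n) ℂ) :=
    inferInstanceAs (FirstCountableTopology (Fin n → Fin n → ℂ))
  refine continuousOn_of_dominated (F := fun (S : Matrix (Fin n) (Fin n) ℂ) g =>
      Real.log (1 + quadForm S g)) (bound := fun g => PT * ∑ i, Complex.normSq (g i))
    (fun S hS => (continuous_log_one_add_quadForm hS.1).aestronglyMeasurable)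
    (fun S hS => Filter.Eventually.of_forall fun g => ?_)
    ((integrable_finsetSum Finset.univ fun i _ => integrable_normSq_complexGaussianVector i).const_mul PT)
    (Filter.Eventually.of_forall fun g => ?_)
  · refine (norm_log_one_add_le (quadForm_nonneg hS.1 g)).trans
      ((quadForm_le_trace_mul hS.1 g).trans ?_)
    exact mul_le_mul_of_nonneg_right hS.2 (Finset.sum_nonneg fun i _ => Complex.normSq_nonneg _)
  · refine ContinuousOn.log ((continuous_quadForm_left g).const_add 1).continuousOn fun S hS => ?_
    linarith [quadForm_nonneg hS.1 g]

theorem trace_re_nonneg {S : Matrix (Fin n) (Fin n) ℂ} (hS : S.PosSemidef) : 0 ≤ S.trace.re :=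
  (Complex.le_def.1 hS.trace_nonneg).1

theorem continuousOn_secrecyRate (h : EuclideanSpace ℂ (Fin n)) (PT : ℝ) :
    ContinuousOn (secrecyRate h) (feasibleSet n PT) := by
  have hq1 : Continuous fun S : Matrix (Fin n) (Fin n) ℂ × Matrix (Fin n) (Fin n) ℂ =>
      1 + quadForm (S.1 + S.2) h.ofLp :=
    ((continuous_quadForm_left h.ofLp).comp (continuous_fst.add continuous_snd)).const_add 1
  have hq2 : Continuous fun S : Matrix (Fin n) (Fin n) ℂ × Matrix (Fin n) (Fin n) ℂ =>
      1 + quadForm S.2 h.ofLp :=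
    ((continuous_quadForm_left h.ofLp).comp continuous_snd).const_add 1
  have hm1 : Set.MapsTo (fun S : Matrix (Fin n) (Fin n) ℂ × Matrix (Fin n) (Fin n) ℂ => S.1 + S.2)
      (feasibleSet n PT) {S | S.PosSemidef ∧ S.trace.re ≤ PT} :=
    fun S hS => ⟨hS.1.add hS.2.1, hS.2.2⟩
  have hm2 : Set.MapsTo (fun S : Matrix (Fin n) (Fin n) ℂ × Matrix (Fin n) (Fin n) ℂ => S.2)
      (feasibleSet n PT) {S | S.PosSemidef ∧ S.trace.re ≤ PT} := fun S hS => ⟨hS.2.1, by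
    have h3 := hS.2.2
    have h1 := trace_re_nonneg hS.1
    rw [trace_add, Complex.add_re] at h3
    linarith⟩
  have hc1 : Continuous fun S : Matrix (Fin n) (Fin n) ℂ × Matrix (Fin n) (Fin n) ℂ =>
      S.1 + S.2 := by fun_prop
  have hc2 : Continuous fun S : Matrix (Fin n) (Fin n) ℂ × Matrix (Fin n) (Fin n) ℂ =>
      S.2 := by fun_prop
  have hG1 := (continuousOn_ergodicRate PT).comp hc1.continuousOn hm1
  have hG2 := (continuousOn_ergodicRate PT).comp hc2.continuousOn hm2
  have hl1 := hq1.continuousOn.log (s := feasibleSet n PT) fun S hS => by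
    linarith [quadForm_nonneg (hS.1.add hS.2.1) h.ofLp]
  have hl2 := hq2.continuousOn.log (s := feasibleSet n PT) fun S hS => by
    linarith [quadForm_nonneg hS.2.1 h.ofLp]
  have hsup : ContinuousOn (fun S : Matrix (Fin n) (Fin n) ℂ × Matrix (Fin n) (Fin n) ℂ => max 0
      (Real.log (1 + quadForm (S.1 + S.2) h.ofLp) - Real.log (1 + quadForm S.2 h.ofLp)
        - (ergodicRate (S.1 + S.2) - ergodicRate S.2))) (feasibleSet n PT) :=
    ContinuousOn.sup continuousOn_const ((hl1.sub hl2).sub (hG1.sub hG2))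
  exact hsup.congr fun S hS => secrecyRate_eq hS.1 hS.2.1

theorem trace_conjTranspose_mul_self_re (C : Matrix (Fin n) (Fin n) ℂ) :
    (Cᴴ * C).trace.re = ∑ j, ∑ i, ‖C i j‖ ^ 2 := by
  simp only [trace, diag_apply, mul_apply, conjTranspose_apply, Complex.re_sum, Complex.star_def,
    ← Complex.normSq_eq_conj_mul_self, Complex.ofReal_re, Complex.normSq_eq_norm_sq]

theorem exists_eq_conjTranspose_mul_self {S : Matrix (Fin n) (Fin n) ℂ} (hS : S.PosSemidef) :
    ∃ C, S = Cᴴ * C := by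
  obtain ⟨U, -, a, ha, rfl⟩ := hS.exists_unitary_diagonal
  refine ⟨diagonal (fun k => ((√(a k) : ℝ) : ℂ)) * Uᴴ, ?_⟩
  rw [conjTranspose_mul, conjTranspose_conjTranspose, diagonal_conjTranspose, ← Matrix.mul_assoc,
    Matrix.mul_assoc U (diagonal _) (diagonal _), diagonal_mul_diagonal]
  congr 3
  funext k
  simp [← Complex.ofReal_mul, Real.mul_self_sqrt (ha k)]

/-- Factor both covariances as `Cᴴ * C`: the trace bounds the entries of `C` by `√PT`, so the set is
the continuous image of a closed subset of a product of balls. -/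
theorem isCompact_feasibleSet (n : ℕ) (PT : ℝ) : IsCompact (feasibleSet n PT) := by
  let K : Set (Matrix (Fin n) (Fin n) ℂ) :=
    Set.univ.pi fun _ => Set.univ.pi fun _ => Metric.closedBall 0 √PT
  have hK : IsCompact K :=
    isCompact_univ_pi fun _ => isCompact_univ_pi fun _ => isCompact_closedBall _ _
  let f : Matrix (Fin n) (Fin n) ℂ × Matrix (Fin n) (Fin n) ℂ →
      Matrix (Fin n) (Fin n) ℂ × Matrix (Fin n) (Fin n) ℂ := fun C => (C.1ᴴ * C.1, C.2ᴴ * C.2)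
  have hf : Continuous f := by fun_prop
  have hcl : IsClosed {C : Matrix (Fin n) (Fin n) ℂ × Matrix (Fin n) (Fin n) ℂ |
      (((f C).1 + (f C).2).trace).re ≤ PT} := by
    refine isClosed_le ?_ continuous_const
    exact Complex.continuous_re.comp
      (Continuous.matrix_trace ((continuous_fst.comp hf).add (continuous_snd.comp hf)))
  have himg : feasibleSet n PT = f '' ((K ×ˢ K) ∩ {C | (((f C).1 + (f C).2).trace).re ≤ PT}) := by
    ext S
    constructor
    · rintro ⟨h1, h2, h3⟩
      obtain ⟨C₁, hC₁⟩ := exists_eq_conjTranspose_mul_self h1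
      obtain ⟨C₂, hC₂⟩ := exists_eq_conjTranspose_mul_self h2
      have hS : f (C₁, C₂) = S := Prod.ext hC₁.symm hC₂.symm
      have hmem : ∀ C : Matrix (Fin n) (Fin n) ℂ, (Cᴴ * C).trace.re ≤ PT → C ∈ K := fun C hC => by
        refine fun i _ j _ => mem_closedBall_zero_iff.2 (Real.le_sqrt_of_sq_le (le_trans ?_ hC))
        rw [trace_conjTranspose_mul_self_re]
        exact (Finset.single_le_sum (f := fun i => ‖C i j‖ ^ 2) (fun _ _ => sq_nonneg _)
          (Finset.mem_univ i)).trans (Finset.single_le_sum (f := fun j => ∑ i, ‖C i j‖ ^ 2)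
            (fun _ _ => Finset.sum_nonneg fun _ _ => sq_nonneg _) (Finset.mem_univ j))
      rw [trace_add, Complex.add_re] at h3
      have t1 := trace_re_nonneg h1
      have t2 := trace_re_nonneg h2
      refine ⟨(C₁, C₂), ⟨⟨hmem C₁ ?_, hmem C₂ ?_⟩, ?_⟩, hS⟩
      · rw [← hC₁]; linarith
      · rw [← hC₂]; linarith
      · change (((f (C₁, C₂)).1 + (f (C₁, C₂)).2).trace).re ≤ PT
        rw [hS, trace_add, Complex.add_re]
        exact h3
    · rintro ⟨C, ⟨-, hC⟩, rfl⟩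
      exact ⟨posSemidef_conjTranspose_mul_self _, posSemidef_conjTranspose_mul_self _, hC⟩
  rw [himg]
  exact ((hK.prod hK).inter_right hcl).image hf

theorem zero_mem_feasibleSet {PT : ℝ} (hPT : 0 ≤ PT) : (0, 0) ∈ feasibleSet n PT :=
  ⟨PosSemidef.zero, PosSemidef.zero, by simpa using hPT⟩

theorem secrecyRate_of_signal_zero (h : EuclideanSpace ℂ (Fin n))
    {B : Matrix (Fin n) (Fin n) ℂ} (hB : B.PosSemidef) : secrecyRate h (0, B) = 0 := by
  rw [secrecyRate_eq PosSemidef.zero hB]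
  simp

theorem exists_isOptimalPair (h : EuclideanSpace ℂ (Fin n)) {PT : ℝ} (hPT : 0 ≤ PT) :
    ∃ S, IsOptimalPair h PT S := by
  obtain ⟨S, hS, hmax⟩ := (isCompact_feasibleSet n PT).exists_isMaxOn
    ⟨_, zero_mem_feasibleSet hPT⟩ (continuousOn_secrecyRate h PT)
  exact ⟨S, hS, hmax⟩

theorem IsOptimalPair.secrecyRate_eq_ganRate {h : EuclideanSpace ℂ (Fin n)} {PT : ℝ}
    {S : Matrix (Fin n) (Fin n) ℂ × Matrix (Fin n) (Fin n) ℂ} (hS : IsOptimalPair h PT S) :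
    secrecyRate h S = ganRate h PT := by
  have : IsGreatest (secrecyRate h '' feasibleSet n PT) (secrecyRate h S) :=
    ⟨⟨S, hS.1, rfl⟩, by rintro _ ⟨T, hT, rfl⟩; exact hS.2 hT⟩
  exact this.csSup_eq.symm

end Existence

/-! ### Structure of optimal pairs and conclusion -/

section Optimal

variable {n : ℕ} {h : EuclideanSpace ℂ (Fin n)} {PT : ℝ}
  {S : Matrix (Fin n) (Fin n) ℂ × Matrix (Fin n) (Fin n) ℂ}

theorem sum_normSq_eq_norm_sq (h : EuclideanSpace ℂ (Fin n)) :
    ∑ k, Complex.normSq (h k) = ‖h‖ ^ 2 := by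
  simp [EuclideanSpace.norm_sq_eq, Complex.normSq_eq_norm_sq]

theorem exists_eq_smul_of_optimal (hh : h ≠ 0) (hS : IsOptimalPair h PT S)
    (hpos : 0 < secrecyRate h S) :
    ∃ c : ℂ, S.1 = vecMulVec (c • h.ofLp) (star (c • h.ofLp)) := by
  obtain ⟨u, hu⟩ := exists_eq_vecMulVec_of_optimal hS hpos
  obtain ⟨U, hU, b, hb, hUb⟩ := hS.1.2.1.exists_unitary_diagonal
  have hU' := conjTranspose_mem_unitaryGroup hU
  have hUU : U * Uᴴ = 1 := mem_unitaryGroup_iff.1 hU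
  have hUU' : Uᴴ * U = 1 := mem_unitaryGroup_iff'.1 hU
  have hhpos : 0 < ∑ k, Complex.normSq (h k) := by
    rw [sum_normSq_eq_norm_sq]
    have := norm_pos_iff.2 hh
    positivity
  have hsum : ∑ k, Complex.normSq ((Uᴴ *ᵥ h.ofLp) k) = ∑ k, Complex.normSq (h k) :=
    sum_normSq_unitary_mulVec hU' _
  -- Pass to the eigenbasis of the noise, where the pair has the form required by
  -- `aligned_of_optimal_loaded`.
  have hpair : (Uᴴ * S.1 * Uᴴᴴ, Uᴴ * S.2 * Uᴴᴴ)
      = (vecMulVec (Uᴴ *ᵥ u) (star (Uᴴ *ᵥ u)), diagonal fun k => (b k : ℂ)) := by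
    refine Prod.ext ?_ ?_
    · simp only [vecMulVec_mulVec_star, hu]
    · simp only [conjTranspose_conjTranspose]
      rw [hUb, Matrix.mul_assoc, Matrix.mul_assoc, hUU', Matrix.mul_one, ← Matrix.mul_assoc, hUU',
        Matrix.one_mul]
  have hrate := secrecyRate_unitary_conj hU' hS.1.1 hS.1.2.1 h.ofLp
  have hfeas := unitary_conj_mem_feasibleSet hU' hS.1
  rw [hpair] at hrate hfeas
  obtain ⟨c, hc⟩ := aligned_of_optimal_loaded (PT := PT) (b := b) (u := Uᴴ *ᵥ u)
    (h := Uᴴ *ᵥ h.ofLp) hb (by rw [hsum]; exact hhpos)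
    (by
      have := hfeas.2.2
      simpa only [trace_add, trace_vecMulVec, trace_diagonal, ← sum_normSq_eq, Complex.add_re,
        Complex.ofReal_re, Complex.re_sum] using this)
    (by rw [hrate]; exact hpos)
    (fun x hx T hT => by
      rw [hrate]
      exact hS.secrecyRate_le (by rw [hx, hsum]; exact hhpos) (by rw [hx, hsum]) hT)
  refine ⟨c, ?_⟩
  have : u = c • h.ofLp := by
    have := congr_arg (fun v => U *ᵥ v) hc
    simpa [mulVec_smul, mulVec_mulVec, hUU] using this
  rw [← this]
  exact hu

theorem vecMulVec_smul_eq_beamformingCov (hh : h ≠ 0) (c : ℂ) :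
    (vecMulVec (c • h.ofLp) (star (c • h.ofLp))).trace.re = Complex.normSq c * ‖h‖ ^ 2 ∧
    vecMulVec (c • h.ofLp) (star (c • h.ofLp)) = beamformingCov h (Complex.normSq c * ‖h‖ ^ 2) := by
  constructor
  · rw [trace_vecMulVec, ← sum_normSq_eq, Complex.ofReal_re]
    simp [Complex.normSq_mul, ← Finset.mul_sum, sum_normSq_eq_norm_sq]
  · have h0 : ‖h‖ ^ 2 ≠ 0 := pow_ne_zero 2 (norm_ne_zero_iff.2 hh)
    rw [beamformingCov, mul_div_cancel_right₀ _ h0]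
    ext i j
    simp only [vecMulVec_apply, Pi.smul_apply, Pi.star_apply, smul_eq_mul, Matrix.smul_apply,
      star_mul', Complex.star_def, Complex.normSq_eq_conj_mul_self]
    ring

theorem IsOptimalPair.signal_eq (hh : h ≠ 0) (hS : IsOptimalPair h PT S)
    (hpos : 0 < secrecyRate h S) :
    0 < S.1.trace.re ∧ S.1.rank = 1 ∧ S.1 = beamformingCov h S.1.trace.re := by
  obtain ⟨c, hc⟩ := exists_eq_smul_of_optimal hh hS hpos
  obtain ⟨h1, h2⟩ := vecMulVec_smul_eq_beamformingCov hh c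
  rw [← hc] at h1 h2
  have hc0 : c ≠ 0 := by
    rintro rfl
    have hz : S = (0, S.2) := Prod.ext (by rw [hc]; simp) rfl
    rw [hz, secrecyRate_of_signal_zero h hS.1.2.1] at hpos
    exact lt_irrefl _ hpos
  have htr : 0 < S.1.trace.re := by
    rw [h1]
    have := Complex.normSq_pos.2 hc0
    have := norm_pos_iff.2 hh
    positivity
  refine ⟨htr, ?_, ?_⟩
  · refine le_antisymm (by rw [hc]; exact rank_vecMulVec_le _ _) (Nat.one_le_iff_ne_zero.2 ?_)
    intro hr
    have hz : S.1 = 0 := by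
      rw [Matrix.rank, Submodule.finrank_eq_zero, LinearMap.range_eq_bot] at hr
      ext i j
      simpa using congr_fun (LinearMap.congr_fun hr (Pi.single j 1)) i
    rw [hz, trace_zero, Complex.zero_re] at htr
    exact lt_irrefl _ htr
  · rw [h1]
    exact h2

end Optimal

theorem theorem2 (n : ℕ) (h : EuclideanSpace ℂ (Fin n)) (hh : h ≠ 0) (PT : ℝ) (hPT : 0 ≤ PT) :
    (∃ S : Matrix (Fin n) (Fin n) ℂ × Matrix (Fin n) (Fin n) ℂ,
      IsOptimalPair h PT S ∧ secrecyRate h S = ganRate h PT ∧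
        0 ≤ S.1.trace.re ∧ S.1 = beamformingCov h S.1.trace.re) ∧
    (0 < ganRate h PT →
      ∀ S : Matrix (Fin n) (Fin n) ℂ × Matrix (Fin n) (Fin n) ℂ, IsOptimalPair h PT S →
        0 < S.1.trace.re ∧ S.1.rank = 1 ∧ S.1 = beamformingCov h S.1.trace.re) := by
  refine ⟨?_, fun hpos S hS => hS.signal_eq hh (hS.secrecyRate_eq_ganRate ▸ hpos)⟩
  obtain ⟨S, hS⟩ := exists_isOptimalPair h hPT
  rcases lt_or_ge 0 (secrecyRate h S) with hpos | hle
  · obtain ⟨h1, -, h3⟩ := hS.signal_eq hh hpos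
    exact ⟨S, hS, hS.secrecyRate_eq_ganRate, h1.le, h3⟩
  -- When the optimal value is zero, the optimizer supplied by compactness need not be aligned; the
  -- zero pair is optimal and has the required form with power `0`.
  · have h0 : IsOptimalPair h PT (0, 0) := by
      refine ⟨zero_mem_feasibleSet hPT, fun T hT => ?_⟩
      have : secrecyRate h T ≤ secrecyRate h S := hS.2 hT
      change secrecyRate h T ≤ secrecyRate h (0, 0)
      rw [secrecyRate_of_signal_zero h PosSemidef.zero]
      exact this.trans hle
    exact ⟨(0, 0), h0, h0.secrecyRate_eq_ganRate, by simp, by simp [beamformingCov]⟩
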